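/- For $j=1,2$ let the data consist of $(\alpha_j,\delta_j,\dot\alpha_j,\dot\delta_j)\in\mathbb R^4$ and $\mathbf q_j,\dot{\mathbf q}_j\in\mathbb R^3$. Put $\mathbf e^\rho_j=(\cos\delta_j\cos\alpha_j,\cos\delta_j\sin\alpha_j,\sin\delta_j)$, $\mathbf e^\alpha_j=(-\sin\alpha_j,\cos\alpha_j,0)$, $\mathbf e^\delta_j=\partial\mathbf e^\rho_j/\partial\delta_j$, $\boldsymbol\eta_j=\dot\alpha_j\cos\delta_j\,\mathbf e^\alpha_j+\dot\delta_j\,\mathbf e^\delta_j$, and, with variables $\rho_j,\dot\rho_j,u_j$, \[ \mathbf r_j=\rho_j\mathbf e^\rho_j+\mathbf q_j,\qquad \dot{\mathbf r}_j=\dot\rho_j\mathbf e^\rho_j+\rho_j\boldsymbol\eta_j+\dot{\mathbf q}_j,\qquad \mathbf c_j=\mathbf r_j\times\dot{\mathbf r}_j, \] \[ \mu\mathbf L_j=(|\dot{\mathbf r}_j|^2-u_j)\mathbf r_j-(\mathbf r_j\cdot\dot{\mathbf r}_j)\dot{\mathbf r}_j,\qquad \mathcal E_j=\tfrac12|\dot{\mathbf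 r}_j|^2-u_j \] (these are the Keplerian integrals, with $u_j$ in place of $\mu/|\mathbf r_j|$ and treated as independent of $\rho_j$). Let $I\subseteq\mathbb R[\rho_1,\rho_2,\dot\rho_1,\dot\rho_2,u_1,u_2]$ be the ideal generated by the seven polynomials that are the components of $\mathbf c_1-\mathbf c_2$ and $\mu\mathbf L_1-\mu\mathbf L_2$, together with $\mathcal E_1-\mathcal E_2$. Let $\mathbf D_j=\mathbf q_j\times\mathbf e^\rho_j$, $\mathbf E_j=\mathbf e^\rho_j\times\boldsymbol\eta_j$, $\mathbf F_j=\mathbf q_j\times\boldsymbol\eta_j+\mathbf e^\rho_j\times\dot{\mathbf q}_j$, $\mathbf G_j=\mathbf q_j\times\dot{\mathbf q}_j$, $\mathbf J=\mathbf E_2\rho_2^2-\mathbf E_1\rho_1^2+\mathbf F_2\rho_2-\mathbf F_1\rho_1+\mathbf G_2-\mathbf G_1$, and $q=(\mathbf D_1\times\mathbf D_2)\cdot\mathbf J\in\mathbb R[\rho_1,\rho_2]$. In \[ \boldsymbol\xi=\bigl[\mu(\mathbf L_1-\mathbf L_2)-(\mathcal E_1\mathbf r_1-\mathcal E_2\mathbf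 r_2)\bigr]\times(\mathbf r_1-\mathbf r_2) \] the $u_j$ cancel; substitute \[ \dot\rho_1=\frac{(\mathbf J\times\mathbf D_2)\cdot(\mathbf D_1\times\mathbf D_2)}{|\mathbf D_1\times\mathbf D_2|^2},\qquad \dot\rho_2=\frac{(\mathbf J\times\mathbf D_1)\cdot(\mathbf D_1\times\mathbf D_2)}{|\mathbf D_1\times\mathbf D_2|^2} \] and put $p_j=\boldsymbol\xi\cdot\mathbf e^\rho_j\in\mathbb R[\rho_1,\rho_2]$. Let $\mathfrak u_j=\mathrm{Res}(p_j,q,\rho_1)$ and $\mathfrak u=\gcd(\mathfrak u_1,\mathfrak u_2)\in\mathbb R[\rho_2]$. Then, for a generic choice of the data (that is, outside the zero set of some real-analytic function on the data space $\mathbb R^{20}$ that is not identically zero), $\mathfrak u$ has degree $9$, it belongs to $I$, and every nonzero polynomial in $\rho_2$ alone that belongs to $I$ has degree at least $\deg\mathfrak u$. In this sense $\mathfrak u$ has the least degree among the univariate polynomials in $\rho_2$ that are consequences of the algebraic Keplerian conservation laws with $u_j$ treated as independent of $\rho_j$, i.e. that are obtained without squaring. -/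

import Mathlib

open scoped Matrix

namespace KeplerLinkage

/-- The data at one epoch: the attributable `(α, δ, α̇, δ̇)`, the heliocentric position `𝐪` of the
observer and its heliocentric velocity `𝐪̇`. -/
abbrev EpochData : Type := (Fin 4 → ℝ) × (Fin 3 → ℝ) × (Fin 3 → ℝ)

/-- The data at the two epochs; index `0` is the first epoch, index `1` the second one. -/
abbrev LinkData : Type := Fin 2 → EpochData

namespace EpochData

/-- Right ascension `α`. -/
def ra (d : EpochData) : ℝ := d.1 0

/-- Declination `δ`. -/
def dec (d : EpochData) : ℝ := d.1 1

/-- Angular rate `α̇`. -/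
def raRate (d : EpochData) : ℝ := d.1 2

/-- Angular rate `δ̇`. -/
def decRate (d : EpochData) : ℝ := d.1 3

/-- Heliocentric position `𝐪` of the observer. -/
def obsPos (d : EpochData) : Fin 3 → ℝ := d.2.1

/-- Heliocentric velocity `𝐪̇` of the observer. -/
def obsVel (d : EpochData) : Fin 3 → ℝ := d.2.2

end EpochData

/-- The line of sight `𝐞^ρ`, as a function of the right ascension and the declination. -/
noncomputable def sight (α δ : ℝ) : Fin 3 → ℝ :=
  ![Real.cos δ * Real.cos α, Real.cos δ * Real.sin α, Real.sin δ]

/-- The unit vector `𝐞^α = (cos δ)⁻¹ ∂𝐞^ρ/∂α`, see `hasDerivAt_sight_ra`. -/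
noncomputable def eAlpha (α : ℝ) : Fin 3 → ℝ := ![-Real.sin α, Real.cos α, 0]

/-- The unit vector `𝐞^δ = ∂𝐞^ρ/∂δ`, see `hasDerivAt_sight_dec`. -/
noncomputable def eDelta (α δ : ℝ) : Fin 3 → ℝ :=
  ![-Real.sin δ * Real.cos α, -Real.sin δ * Real.sin α, Real.cos δ]

theorem hasDerivAt_sight_ra (α δ : ℝ) :
    HasDerivAt (fun a => sight a δ) (Real.cos δ • eAlpha α) α := by
  rw [hasDerivAt_pi]
  intro i
  fin_cases i
  · simpa [sight, eAlpha] using (Real.hasDerivAt_cos α).const_mul (Real.cos δ)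
  · simpa [sight, eAlpha] using (Real.hasDerivAt_sin α).const_mul (Real.cos δ)
  · simpa [sight, eAlpha] using hasDerivAt_const α (Real.sin δ)

theorem hasDerivAt_sight_dec (α δ : ℝ) :
    HasDerivAt (fun t => sight α t) (eDelta α δ) δ := by
  rw [hasDerivAt_pi]
  intro i
  fin_cases i
  · simpa [sight, eDelta] using (Real.hasDerivAt_cos δ).mul_const (Real.cos α)
  · simpa [sight, eDelta] using (Real.hasDerivAt_cos δ).mul_const (Real.sin α)
  · simpa [sight, eDelta] using Real.hasDerivAt_sin δ

namespace EpochData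

/-- The line of sight `𝐞^ρ` of the data. -/
noncomputable def los (d : EpochData) : Fin 3 → ℝ := sight d.ra d.dec

/-- The vector `𝛈 = α̇ cos δ 𝐞^α + δ̇ 𝐞^δ`. -/
noncomputable def eta (d : EpochData) : Fin 3 → ℝ :=
  (d.raRate * Real.cos d.dec) • eAlpha d.ra + d.decRate • eDelta d.ra d.dec

/-- The coefficient `𝐃 = 𝐪 × 𝐞^ρ` of `ρ̇` in the angular momentum. -/
noncomputable def vecD (d : EpochData) : Fin 3 → ℝ := d.obsPos ⨯₃ d.los

/-- The coefficient `𝐄 = 𝐞^ρ × 𝛈` of `ρ²` in the angular momentum. -/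
noncomputable def vecE (d : EpochData) : Fin 3 → ℝ := d.los ⨯₃ d.eta

/-- The coefficient `𝐅 = 𝐪 × 𝛈 + 𝐞^ρ × 𝐪̇` of `ρ` in the angular momentum. -/
noncomputable def vecF (d : EpochData) : Fin 3 → ℝ := d.obsPos ⨯₃ d.eta + d.los ⨯₃ d.obsVel

/-- The constant term `𝐆 = 𝐪 × 𝐪̇` of the angular momentum. -/
noncomputable def vecG (d : EpochData) : Fin 3 → ℝ := d.obsPos ⨯₃ d.obsVel

end EpochData

section Integrals

/- The Keplerian integrals are polynomial expressions in `ρ`, `ρ̇`, `u`, where `u` stands for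
`μ / |𝐫|`. They are written here with `ρ`, `ρ̇`, `u` in an arbitrary commutative `ℝ`-algebra `S`, so
that the variables of a polynomial ring can be inserted. -/

variable {S : Type} [CommRing S] [Algebra ℝ S]

/-- A real vector regarded as a vector with (constant) entries in `S`. -/
def emb (S : Type) [CommRing S] [Algebra ℝ S] (v : Fin 3 → ℝ) : Fin 3 → S :=
  fun i => algebraMap ℝ S (v i)

/-- Heliocentric position `𝐫 = ρ 𝐞^ρ + 𝐪`. -/
noncomputable def pos (d : EpochData) (ρ : S) : Fin 3 → S :=
  ρ • emb S d.los + emb S d.obsPos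

/-- Heliocentric velocity `𝐫̇ = ρ̇ 𝐞^ρ + ρ 𝛈 + 𝐪̇`. -/
noncomputable def vel (d : EpochData) (ρ ρ' : S) : Fin 3 → S :=
  ρ' • emb S d.los + ρ • emb S d.eta + emb S d.obsVel

/-- Angular momentum `𝐜 = 𝐫 × 𝐫̇`. -/
noncomputable def angMom (d : EpochData) (ρ ρ' : S) : Fin 3 → S :=
  pos d ρ ⨯₃ vel d ρ ρ'

/-- Laplace-Lenz vector times `μ`: `μ𝐋 = (|𝐫̇|² - u) 𝐫 - (𝐫 · 𝐫̇) 𝐫̇`. -/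
noncomputable def muLenz (d : EpochData) (ρ ρ' u : S) : Fin 3 → S :=
  (vel d ρ ρ' ⬝ᵥ vel d ρ ρ' - u) • pos d ρ - (pos d ρ ⬝ᵥ vel d ρ ρ') • vel d ρ ρ'

/-- Energy `ℰ = |𝐫̇|² / 2 - u`. -/
noncomputable def energy (d : EpochData) (ρ ρ' u : S) : S :=
  (1 / 2 : ℝ) • (vel d ρ ρ' ⬝ᵥ vel d ρ ρ') - u

/-- `𝛏 = [μ(𝐋₁ - 𝐋₂) - (ℰ₁𝐫₁ - ℰ₂𝐫₂)] × (𝐫₁ - 𝐫₂)`. -/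
noncomputable def xi (d : LinkData) (ρ ρ' u : Fin 2 → S) : Fin 3 → S :=
  (muLenz (d 0) (ρ 0) (ρ' 0) (u 0) - muLenz (d 1) (ρ 1) (ρ' 1) (u 1)
      - (energy (d 0) (ρ 0) (ρ' 0) (u 0) • pos (d 0) (ρ 0)
        - energy (d 1) (ρ 1) (ρ' 1) (u 1) • pos (d 1) (ρ 1)))
    ⨯₃ (pos (d 0) (ρ 0) - pos (d 1) (ρ 1))

/-- The quantities `u₁`, `u₂` cancel out in `𝛏`. -/
theorem xi_eq_xi (d : LinkData) (ρ ρ' u w : Fin 2 → S) : xi d ρ ρ' u = xi d ρ ρ' w := by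
  have key : ∀ (e : EpochData) (x y z : S), muLenz e x y z - energy e x y z • pos e x
      = muLenz e x y 0 - energy e x y 0 • pos e x := by
    intro e x y z
    simp only [muLenz, energy, sub_smul, sub_zero]
    abel
  have key2 : ∀ (z : Fin 2 → S), xi d ρ ρ' z = xi d ρ ρ' 0 := by
    intro z
    unfold xi
    rw [sub_sub_sub_comm, key, key (d 1), ← sub_sub_sub_comm]
    rfl
  rw [key2 u, key2 w]

/-- `𝐉 = 𝐄₂ρ₂² - 𝐄₁ρ₁² + 𝐅₂ρ₂ - 𝐅₁ρ₁ + 𝐆₂ - 𝐆₁`. -/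
noncomputable def vecJ (d : LinkData) (ρ : Fin 2 → S) : Fin 3 → S :=
  ρ 1 ^ 2 • emb S (d 1).vecE - ρ 0 ^ 2 • emb S (d 0).vecE
    + ρ 1 • emb S (d 1).vecF - ρ 0 • emb S (d 0).vecF
    + emb S (d 1).vecG - emb S (d 0).vecG

/-- `𝐜₁ - 𝐜₂ = 𝐃₁ρ̇₁ - 𝐃₂ρ̇₂ - 𝐉(ρ₁, ρ₂)`. -/
theorem angMom_sub_angMom (d : LinkData) (ρ ρ' : Fin 2 → S) :
    angMom (d 0) (ρ 0) (ρ' 0) - angMom (d 1) (ρ 1) (ρ' 1)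
      = ρ' 0 • emb S (d 0).vecD - ρ' 1 • emb S (d 1).vecD - vecJ d ρ := by
  ext i
  fin_cases i <;>
    simp [angMom, pos, vel, vecJ, emb, EpochData.vecD, EpochData.vecE, EpochData.vecF,
      EpochData.vecG, cross_apply] <;> ring

end Integrals

/-- `𝐃₁ × 𝐃₂`. -/
noncomputable def crossD (d : LinkData) : Fin 3 → ℝ := (d 0).vecD ⨯₃ (d 1).vecD

section Bivariate

open Polynomial

/- Polynomials in `ρ₁, ρ₂` are elements of `ℝ[X][X]`: the outer variable is `ρ₁`, and the
coefficients are univariate polynomials in `ρ₂`. -/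

/-- The variables `ρ₁, ρ₂` of `ℝ[ρ₂][ρ₁]`. -/
noncomputable def rhoVar : Fin 2 → ℝ[X][X] := ![X, C X]

/-- `q = (𝐃₁ × 𝐃₂) · 𝐉(ρ₁, ρ₂)`. -/
noncomputable def qPoly (d : LinkData) : ℝ[X][X] :=
  emb ℝ[X][X] (crossD d) ⬝ᵥ vecJ d rhoVar

/-- The radial velocities as polynomials in `ρ₁, ρ₂`:
`ρ̇₁ = (𝐉 × 𝐃₂) · (𝐃₁ × 𝐃₂) / |𝐃₁ × 𝐃₂|²`, `ρ̇₂ = (𝐉 × 𝐃₁) · (𝐃₁ × 𝐃₂) / |𝐃₁ × 𝐃₂|²`. -/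
noncomputable def rhoDotPoly (d : LinkData) : Fin 2 → ℝ[X][X] :=
  ![(crossD d ⬝ᵥ crossD d)⁻¹ •
      ((vecJ d rhoVar ⨯₃ emb ℝ[X][X] (d 1).vecD) ⬝ᵥ emb ℝ[X][X] (crossD d)),
    (crossD d ⬝ᵥ crossD d)⁻¹ •
      ((vecJ d rhoVar ⨯₃ emb ℝ[X][X] (d 0).vecD) ⬝ᵥ emb ℝ[X][X] (crossD d))]

/-- `𝛏` as a vector of polynomials in `ρ₁, ρ₂`, after the elimination of `ρ̇₁, ρ̇₂`. By `xi_eq_xi`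
the value inserted for `u` is immaterial. -/
noncomputable def xiPoly (d : LinkData) : Fin 3 → ℝ[X][X] :=
  xi d rhoVar (rhoDotPoly d) 0

/-- `p₁ = 𝛏 · 𝐞^ρ₁` (index `0`) and `p₂ = 𝛏 · 𝐞^ρ₂` (index `1`). -/
noncomputable def pPoly (d : LinkData) (j : Fin 2) : ℝ[X][X] :=
  xiPoly d ⬝ᵥ emb ℝ[X][X] (d j).los

/-- `𝔲ⱼ = Res(pⱼ, q, ρ₁)`, a univariate polynomial in `ρ₂`. -/
noncomputable def uRes (d : LinkData) (j : Fin 2) : ℝ[X] :=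
  resultant (pPoly d j) (qPoly d)

open Classical in
/-- `𝔲 = gcd(𝔲₁, 𝔲₂)`, a univariate polynomial in `ρ₂`. -/
noncomputable def uPoly (d : LinkData) : ℝ[X] :=
  EuclideanDomain.gcd (uRes d 0) (uRes d 1)

end Bivariate

/-- The six variables `ρⱼ, ρ̇ⱼ, uⱼ`, for `j = 1, 2`. -/
inductive KepVar : Type
  | rho (j : Fin 2) : KepVar
  | rhoDot (j : Fin 2) : KepVar
  | u (j : Fin 2) : KepVar

section KepIdeal

open MvPolynomial

/-- The polynomial `𝐜ⱼ`. -/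
noncomputable def angMomPoly (d : LinkData) (j : Fin 2) : Fin 3 → MvPolynomial KepVar ℝ :=
  angMom (d j) (X (KepVar.rho j)) (X (KepVar.rhoDot j))

/-- The polynomial `μ𝐋ⱼ`. -/
noncomputable def muLenzPoly (d : LinkData) (j : Fin 2) : Fin 3 → MvPolynomial KepVar ℝ :=
  muLenz (d j) (X (KepVar.rho j)) (X (KepVar.rhoDot j)) (X (KepVar.u j))

/-- The polynomial `ℰⱼ`. -/
noncomputable def energyPoly (d : LinkData) (j : Fin 2) : MvPolynomial KepVar ℝ :=
  energy (d j) (X (KepVar.rho j)) (X (KepVar.rhoDot j)) (X (KepVar.u j))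

/-- The ideal `I` generated by the seven polynomials `𝐜₁ - 𝐜₂`, `μ𝐋₁ - μ𝐋₂`, `ℰ₁ - ℰ₂`. -/
noncomputable def kepIdeal (d : LinkData) : Ideal (MvPolynomial KepVar ℝ) :=
  Ideal.span
    (Set.range (fun i => angMomPoly d 0 i - angMomPoly d 1 i)
      ∪ Set.range (fun i => muLenzPoly d 0 i - muLenzPoly d 1 i)
      ∪ {energyPoly d 0 - energyPoly d 1})

/-- The univariate polynomial `g` regarded as a polynomial in the variable `ρ₂`. -/
noncomputable def inRho2 (g : Polynomial ℝ) : MvPolynomial KepVar ℝ :=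
  Polynomial.aeval (X (KepVar.rho 1)) g

end KepIdeal

/-- A property of the data holds generically if it holds outside the zero set of some real-analytic
function on the (20-dimensional) data space that does not vanish identically. -/
def Generic (P : LinkData → Prop) : Prop :=
  ∃ Φ : LinkData → ℝ, AnalyticOnNhd ℝ Φ Set.univ ∧ (∃ d, Φ d ≠ 0) ∧ ∀ d, Φ d ≠ 0 → P d

end KeplerLinkage

/-! Let A = ℝ[ρ₁, ρ₂]/(q), which is `Conic d`: if the coefficient `qA` of ρ₁² is nonzero, A is free
of rank two over ℝ[ρ₂], and Res(pⱼ, q, ρ₁) is up to a unit the norm N(pⱼ) of the class of pⱼ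
(`exists_resultant_eq_mul_norm`).

On q = 0 the prescribed ρ̇ⱼ are exactly those with 𝐜₁ = 𝐜₂ =: 𝐜. Both factors of 𝛏 are then
orthogonal to 𝐜, so 𝛏 is parallel to 𝐜 and p₁ (𝐜 · 𝐞^ρ₂) = p₂ (𝐜 · 𝐞^ρ₁) in A (`pVal_mul_eq`). The
form ℓⱼ = 𝐜ⱼ · 𝐞^ρⱼ is affine in ρⱼ alone, and the conic passes through the point where ℓ₁ = ℓ₂ = 0.
Hence, up to constants, N(ℓ₂) = (ρ₂ - r₂)² and N(ℓ₁) = (ρ₂ - r₂)(ρ₂ - r₁), where r₁, r₂ are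
`rootOne`, `rootTwo`. So N(p₁)(ρ₂ - r₂) and N(p₂)(ρ₂ - r₁) are proportional. If r₁ ≠ r₂, then N(p₁)
= (ρ₂ - r₁) h with h associated to 𝔲 (`exists_common_factor`). The terms of total degree 6 in p₁
cancel, so N(p₁) has degree at most 10, and h has degree 9 once the coefficient of degree 10 is
nonzero.

Membership in I: modulo I one has q = p₁ = p₂ = 0, and the resultants are combinations of these
(`inRho2_uPoly_mem`).

Minimality: over ℝ[ρ₂]/(h) the norm of p₁ = re + im · ρ₁ vanishes, and ρ₁ = -re/im is a common zero
of q, p₁ and p₂ if im and ℓ₁ are units there. From 𝛏 = 0 one can solve for u₁, u₂, so this zero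
extends to a zero of I whose ρ₂ is the class of the variable. Every univariate member of I is
therefore divisible by h (`dvd_of_inRho2_mem`).

Genericity: the non-degeneracy conditions say that finitely many quotients of analytic functions do
not vanish, and a single explicit choice of data satisfies all of them. -/

namespace KeplerLinkage

/-! ### Vector identities in R³ over a commutative ring. -/

section VectorAlgebra

variable {R : Type*} [CommRing R]

/-- The part `½|𝐯|²𝐫 - (𝐫·𝐯)𝐯` of the Laplace-Lenz vector that is left after the subtraction of
the energy times the position (`h` stands for `½`). -/
def lenzRest (h : R) (r v : Fin 3 → R) : Fin 3 → R :=
  (h * (v ⬝ᵥ v)) • r - (r ⬝ᵥ v) • v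

theorem lenzRest_dot_cross (h : R) (r v : Fin 3 → R) : lenzRest h r v ⬝ᵥ (r ⨯₃ v) = 0 := by
  simp [lenzRest, cross_apply, dotProduct, Fin.sum_univ_three]
  ring

/-- Over a field this says that two vectors in the plane orthogonal to c have a cross product
parallel to c. Parallelism is expressed as a vanishing cross product so that it makes sense over any
commutative ring. -/
theorem cross_cross_eq_zero_of_dot_eq_zero {w x c : Fin 3 → R} (hw : w ⬝ᵥ c = 0)
    (hx : x ⬝ᵥ c = 0) : (w ⨯₃ x) ⨯₃ c = 0 := by
  have key : (w ⨯₃ x) ⨯₃ c = (w ⬝ᵥ c) • x - (x ⬝ᵥ c) • w := by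
    ext i
    fin_cases i <;> simp [cross_apply, dotProduct, Fin.sum_univ_three] <;> ring
  rw [key, hw, hx]
  simp

theorem dot_mul_dot_of_cross_eq_zero {x c : Fin 3 → R} (h : x ⨯₃ c = 0) (a b : Fin 3 → R) :
    (x ⬝ᵥ a) * (c ⬝ᵥ b) = (x ⬝ᵥ b) * (c ⬝ᵥ a) := by
  have key : (x ⬝ᵥ a) * (c ⬝ᵥ b) - (x ⬝ᵥ b) * (c ⬝ᵥ a) = (x ⨯₃ c) ⬝ᵥ (a ⨯₃ b) := by
    simp [cross_apply, dotProduct, Fin.sum_univ_three]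
    ring
  rw [h, zero_dotProduct] at key
  exact sub_eq_zero.mp key

/-- A vector orthogonal to three vectors with invertible determinant vanishes. -/
theorem eq_zero_of_dot_eq_zero {x a b c : Fin 3 → R} (hu : IsUnit ((a ⨯₃ b) ⬝ᵥ c))
    (ha : x ⬝ᵥ a = 0) (hb : x ⬝ᵥ b = 0) (hc : x ⬝ᵥ c = 0) : x = 0 := by
  have key : ((a ⨯₃ b) ⬝ᵥ c) • x
      = (x ⬝ᵥ a) • (b ⨯₃ c) + (x ⬝ᵥ b) • (c ⨯₃ a) + (x ⬝ᵥ c) • (a ⨯₃ b) := by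
    ext i
    fin_cases i <;> simp [cross_apply, dotProduct, Fin.sum_univ_three] <;> ring
  rw [ha, hb, hc] at key
  simp only [zero_smul, add_zero] at key
  exact (hu.smul_eq_zero).mp key

/-- If `w × x = 0` and `x` is unimodular then `w` is a multiple of `x`. -/
theorem exists_eq_smul_of_cross_eq_zero {w x y : Fin 3 → R} (hu : IsUnit (y ⬝ᵥ x))
    (h : w ⨯₃ x = 0) : ∃ k : R, w = k • x := by
  obtain ⟨t, ht⟩ := hu.exists_left_inv
  refine ⟨t * (y ⬝ᵥ w), ?_⟩
  have key : (y ⬝ᵥ x) • w - (y ⬝ᵥ w) • x = y ⨯₃ (w ⨯₃ x) := by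
    ext i
    fin_cases i <;> simp [cross_apply, dotProduct, Fin.sum_univ_three] <;> ring
  rw [h, map_zero] at key
  have h2 := congrArg (t • ·) (sub_eq_zero.mp key)
  simpa [smul_smul, ht] using h2

/-- The component of `𝛏` along the first line of sight, without the terms of highest degree, which
cancel. -/
theorem cross_lenzRest_dot (h s s' : R) (e q w r v : Fin 3 → R) :
    ((lenzRest h (s • e + q) (s' • e + w) - lenzRest h r v) ⨯₃ (s • e + q - r)) ⬝ᵥ e
      = -(((s • e + q) ⬝ᵥ (s' • e + w)) * ((w ⨯₃ q) ⬝ᵥ e))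
        - (((h * ((s' • e + w) ⬝ᵥ (s' • e + w))) • q
            - ((s • e + q) ⬝ᵥ (s' • e + w)) • w) ⨯₃ r) ⬝ᵥ e
        - (lenzRest h r v ⨯₃ q) ⬝ᵥ e
        - (r ⬝ᵥ v) * ((v ⨯₃ r) ⬝ᵥ e) := by
  simp [lenzRest, cross_apply, dotProduct, Fin.sum_univ_three]
  ring

end VectorAlgebra

/-! ### The conservation laws at points with coordinates in an arbitrary ℝ-algebra. -/

section Emb

variable {S : Type} [CommRing S] [Algebra ℝ S]

theorem emb_cross (v w : Fin 3 → ℝ) : emb S (v ⨯₃ w) = emb S v ⨯₃ emb S w := by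
  ext i
  fin_cases i <;> simp [emb, cross_apply]

theorem emb_dot (v w : Fin 3 → ℝ) : emb S v ⬝ᵥ emb S w = algebraMap ℝ S (v ⬝ᵥ w) := by
  simp [emb, dotProduct]

/-- `q = (𝐃₁ × 𝐃₂) · 𝐉` with arbitrary values for the variables. -/
noncomputable def qVal (d : LinkData) (ρ : Fin 2 → S) : S :=
  emb S (crossD d) ⬝ᵥ vecJ d ρ

/-- The radial velocities with arbitrary values for the variables. -/
noncomputable def rhoDotVal (d : LinkData) (ρ : Fin 2 → S) : Fin 2 → S :=
  ![(crossD d ⬝ᵥ crossD d)⁻¹ •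
      ((vecJ d ρ ⨯₃ emb S (d 1).vecD) ⬝ᵥ emb S (crossD d)),
    (crossD d ⬝ᵥ crossD d)⁻¹ •
      ((vecJ d ρ ⨯₃ emb S (d 0).vecD) ⬝ᵥ emb S (crossD d))]

/-- `pⱼ` with arbitrary values for the variables. -/
noncomputable def pVal (d : LinkData) (ρ : Fin 2 → S) (j : Fin 2) : S :=
  xi d ρ (rhoDotVal d ρ) 0 ⬝ᵥ emb S (d j).los

theorem qPoly_eq (d : LinkData) : qPoly d = qVal d rhoVar := rfl

theorem pPoly_eq (d : LinkData) (j : Fin 2) : pPoly d j = pVal d rhoVar j := rfl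

/-- The formulas for ρ̇₁, ρ̇₂ are Cramer's rule for 𝐃₁ρ̇₁ - 𝐃₂ρ̇₂ = 𝐉 in the plane spanned by 𝐃₁,
𝐃₂. What remains of the equation is its component along 𝐃₁ × 𝐃₂, and that is q. -/
theorem angMom_eq_of_qVal_eq_zero (d : LinkData) (ρ : Fin 2 → S)
    (hK : crossD d ⬝ᵥ crossD d ≠ 0) (hq : qVal d ρ = 0) :
    angMom (d 0) (ρ 0) (rhoDotVal d ρ 0) = angMom (d 1) (ρ 1) (rhoDotVal d ρ 1) := by
  rw [← sub_eq_zero, angMom_sub_angMom]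
  have hu : IsUnit (algebraMap ℝ S (crossD d ⬝ᵥ crossD d)) :=
    (IsUnit.mk0 _ hK).map (algebraMap ℝ S)
  rw [← hu.smul_eq_zero]
  have h0 : algebraMap ℝ S (crossD d ⬝ᵥ crossD d) * rhoDotVal d ρ 0
      = (vecJ d ρ ⨯₃ emb S (d 1).vecD) ⬝ᵥ emb S (crossD d) := by
    simp [rhoDotVal, Algebra.smul_def, ← mul_assoc, ← map_mul, hK]
  have h1 : algebraMap ℝ S (crossD d ⬝ᵥ crossD d) * rhoDotVal d ρ 1
      = (vecJ d ρ ⨯₃ emb S (d 0).vecD) ⬝ᵥ emb S (crossD d) := by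
    simp [rhoDotVal, Algebra.smul_def, ← mul_assoc, ← map_mul, hK]
  rw [smul_sub, smul_sub, smul_smul, smul_smul, h0, h1, ← emb_dot]
  unfold qVal at hq
  unfold crossD at hq ⊢
  rw [emb_cross] at hq ⊢
  generalize vecJ d ρ = j at *
  generalize emb S (d 0).vecD = a at *
  generalize emb S (d 1).vecD = b at *
  have key : ((j ⨯₃ b) ⬝ᵥ (a ⨯₃ b)) • a - ((j ⨯₃ a) ⬝ᵥ (a ⨯₃ b)) • b
      - ((a ⨯₃ b) ⬝ᵥ (a ⨯₃ b)) • j = -(((a ⨯₃ b) ⬝ᵥ j) • (a ⨯₃ b)) := by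
    ext i
    fin_cases i <;> simp [cross_apply, dotProduct, Fin.sum_univ_three] <;> ring
  rw [key, hq]
  simp

/-- Substituting 𝐉 = 𝐃₁ρ̇₁ - 𝐃₂ρ̇₂ makes q a triple product with a repeated vector and reduces both
Cramer quotients to the given velocities. -/
theorem eq_of_angMom_eq (d : LinkData) (ρ ρ' : Fin 2 → S)
    (hK : crossD d ⬝ᵥ crossD d ≠ 0)
    (h : angMom (d 0) (ρ 0) (ρ' 0) = angMom (d 1) (ρ 1) (ρ' 1)) :
    qVal d ρ = 0 ∧ rhoDotVal d ρ = ρ' := by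
  have hJ : vecJ d ρ = ρ' 0 • emb S (d 0).vecD - ρ' 1 • emb S (d 1).vecD := by
    rw [← sub_eq_zero, angMom_sub_angMom, sub_eq_zero] at h
    exact h.symm
  have hK' : (crossD d ⬝ᵥ crossD d)⁻¹ • (emb S (crossD d) ⬝ᵥ emb S (crossD d)) = 1 := by
    rw [emb_dot, Algebra.smul_def, ← map_mul, inv_mul_cancel₀ hK, map_one]
  unfold qVal rhoDotVal
  rw [hJ]
  have hX : emb S (crossD d) = emb S (d 0).vecD ⨯₃ emb S (d 1).vecD := emb_cross _ _
  generalize emb S (crossD d) = x at *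
  generalize emb S (d 0).vecD = a at *
  generalize emb S (d 1).vecD = b at *
  subst hX
  refine ⟨?_, ?_⟩
  · simp [cross_apply, dotProduct, Fin.sum_univ_three]
    ring
  have k0 : ((ρ' 0 • a - ρ' 1 • b) ⨯₃ b) ⬝ᵥ (a ⨯₃ b) = ((a ⨯₃ b) ⬝ᵥ (a ⨯₃ b)) * ρ' 0 := by
    simp [cross_apply, dotProduct, Fin.sum_univ_three]
    ring
  have k1 : ((ρ' 0 • a - ρ' 1 • b) ⨯₃ a) ⬝ᵥ (a ⨯₃ b) = ((a ⨯₃ b) ⬝ᵥ (a ⨯₃ b)) * ρ' 1 := by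
    simp [cross_apply, dotProduct, Fin.sum_univ_three]
    ring
  ext i
  fin_cases i
  · simp only [Fin.zero_eta, Matrix.cons_val_zero, k0]
    rw [← smul_mul_assoc, hK', one_mul]
  · simp only [Fin.mk_one, Matrix.cons_val_one, Matrix.cons_val_fin_one, k1]
    rw [← smul_mul_assoc, hK', one_mul]

/-- The term u𝐫 occurs in μ𝐋 and in ℰ𝐫 with the same sign and cancels, while |𝐯|²𝐫 - ½|𝐯|²𝐫 leaves
½|𝐯|²𝐫. -/
theorem muLenz_sub_energy_smul_pos (e : EpochData) (x y z : S) :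
    muLenz e x y z - energy e x y z • pos e x
      = lenzRest (algebraMap ℝ S (1 / 2)) (pos e x) (vel e x y) := by
  have h2 : algebraMap ℝ S (1 / 2) + algebraMap ℝ S (1 / 2) = 1 := by
    rw [← map_add, ← map_one (algebraMap ℝ S)]
    norm_num
  have he : energy e x y z = algebraMap ℝ S (1 / 2) * (vel e x y ⬝ᵥ vel e x y) - z := by
    rw [energy, Algebra.smul_def]
  rw [he, muLenz, lenzRest]
  generalize algebraMap ℝ S (1 / 2) = h at *
  generalize hg : vel e x y ⬝ᵥ vel e x y = n
  have : (h + h) * n = n := by rw [h2, one_mul]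
  rw [sub_right_comm, ← sub_smul]
  congr 2
  linear_combination -this

theorem xi_eq_lenzRest (d : LinkData) (ρ ρ' u : Fin 2 → S) :
    xi d ρ ρ' u = (lenzRest (algebraMap ℝ S (1 / 2)) (pos (d 0) (ρ 0)) (vel (d 0) (ρ 0) (ρ' 0))
      - lenzRest (algebraMap ℝ S (1 / 2)) (pos (d 1) (ρ 1)) (vel (d 1) (ρ 1) (ρ' 1)))
      ⨯₃ (pos (d 0) (ρ 0) - pos (d 1) (ρ 1)) := by
  rw [← muLenz_sub_energy_smul_pos (d 0) _ _ (u 0), ← muLenz_sub_energy_smul_pos (d 1) _ _ (u 1)]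
  unfold xi
  rw [sub_sub_sub_comm]

/-- At each epoch 𝐫 and the rest of the Lenz vector lie in the orbital plane. When 𝐜₁ = 𝐜₂ the two
planes have the same normal, so both factors of 𝛏 are orthogonal to 𝐜. -/
theorem xi_cross_angMom (d : LinkData) (ρ ρ' u : Fin 2 → S)
    (h : angMom (d 0) (ρ 0) (ρ' 0) = angMom (d 1) (ρ 1) (ρ' 1)) :
    xi d ρ ρ' u ⨯₃ angMom (d 0) (ρ 0) (ρ' 0) = 0 := by
  rw [xi_eq_lenzRest]
  apply cross_cross_eq_zero_of_dot_eq_zero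
  · rw [sub_dotProduct, angMom, lenzRest_dot_cross]
    change 0 - _ ⬝ᵥ angMom (d 0) (ρ 0) (ρ' 0) = 0
    rw [h, angMom, lenzRest_dot_cross, sub_zero]
  · rw [sub_dotProduct, angMom, dot_self_cross]
    change 0 - _ ⬝ᵥ angMom (d 0) (ρ 0) (ρ' 0) = 0
    rw [h, angMom, dot_self_cross, sub_zero]

/-- The coefficients 𝐃 of ρ̇ and 𝐄 of ρ² are both orthogonal to 𝐞^ρ, so only an affine form in ρ
survives. -/
theorem angMom_dot_los (e : EpochData) (x y : S) :
    angMom e x y ⬝ᵥ emb S e.los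
      = algebraMap ℝ S (e.vecF ⬝ᵥ e.los) * x + algebraMap ℝ S (e.vecG ⬝ᵥ e.los) := by
  simp [angMom, pos, vel, emb, EpochData.vecF, EpochData.vecG, cross_apply, dotProduct,
    Fin.sum_univ_three]
  ring

/-- `p₁ (𝐜 · 𝐞^ρ₂) = p₂ (𝐜 · 𝐞^ρ₁)` where `q` vanishes. -/
theorem pVal_mul_eq (d : LinkData) (ρ : Fin 2 → S) (hK : crossD d ⬝ᵥ crossD d ≠ 0)
    (hq : qVal d ρ = 0) :
    pVal d ρ 0 * (algebraMap ℝ S ((d 1).vecF ⬝ᵥ (d 1).los) * ρ 1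
        + algebraMap ℝ S ((d 1).vecG ⬝ᵥ (d 1).los))
      = pVal d ρ 1 * (algebraMap ℝ S ((d 0).vecF ⬝ᵥ (d 0).los) * ρ 0
        + algebraMap ℝ S ((d 0).vecG ⬝ᵥ (d 0).los)) := by
  have hc := angMom_eq_of_qVal_eq_zero d ρ hK hq
  have h := dot_mul_dot_of_cross_eq_zero (xi_cross_angMom d ρ _ 0 hc)
    (emb S (d 0).los) (emb S (d 1).los)
  rw [angMom_dot_los, hc, angMom_dot_los] at h
  exact h

theorem xi_eq_zero (d : LinkData) (ρ ρ' u : Fin 2 → S)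
    (hL : muLenz (d 0) (ρ 0) (ρ' 0) (u 0) = muLenz (d 1) (ρ 1) (ρ' 1) (u 1))
    (hE : energy (d 0) (ρ 0) (ρ' 0) (u 0) = energy (d 1) (ρ 1) (ρ' 1) (u 1)) :
    xi d ρ ρ' u = 0 := by
  unfold xi
  rw [hL, hE, sub_self, ← smul_sub, zero_sub, map_neg, map_smul]
  simp

/-- Where `q`, `p₁`, `p₂` vanish, values of `u₁`, `u₂` can be found for which all the algebraic
Keplerian conservation laws hold. -/
theorem exists_conservation (d : LinkData) (ρ : Fin 2 → S) (hK : crossD d ⬝ᵥ crossD d ≠ 0)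
    (hτ : ((d 0).los ⨯₃ (d 1).los) ⬝ᵥ ((d 0).obsPos - (d 1).obsPos) ≠ 0)
    (hq : qVal d ρ = 0) (hp : ∀ j, pVal d ρ j = 0) :
    ∃ ρ' u : Fin 2 → S, angMom (d 0) (ρ 0) (ρ' 0) = angMom (d 1) (ρ 1) (ρ' 1) ∧
      muLenz (d 0) (ρ 0) (ρ' 0) (u 0) = muLenz (d 1) (ρ 1) (ρ' 1) (u 1) ∧
      energy (d 0) (ρ 0) (ρ' 0) (u 0) = energy (d 1) (ρ 1) (ρ' 1) (u 1) := by
  set ρ' := rhoDotVal d ρ with hρ'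
  -- The terms ρⱼ𝐞^ρⱼ drop out of this determinant, which is thus a real constant and a unit in
  -- every S.
  have hdet : (emb S (d 0).los ⨯₃ emb S (d 1).los) ⬝ᵥ (pos (d 0) (ρ 0) - pos (d 1) (ρ 1))
      = algebraMap ℝ S (((d 0).los ⨯₃ (d 1).los) ⬝ᵥ ((d 0).obsPos - (d 1).obsPos)) := by
    simp [pos, emb, cross_apply, dotProduct, Fin.sum_univ_three]
    ring
  have hu : IsUnit ((emb S (d 0).los ⨯₃ emb S (d 1).los) ⬝ᵥ
      (pos (d 0) (ρ 0) - pos (d 1) (ρ 1))) := by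
    rw [hdet]
    exact (IsUnit.mk0 _ hτ).map (algebraMap ℝ S)
  have hxi : xi d ρ ρ' 0 = 0 := by
    refine eq_zero_of_dot_eq_zero hu (hp 0) (hp 1) ?_
    rw [xi, dotProduct_comm, dot_cross_self]
  rw [xi_eq_lenzRest] at hxi
  obtain ⟨k, hk⟩ := exists_eq_smul_of_cross_eq_zero hu hxi
  -- With Δ the difference of the two Lenz rests, 𝛏 = 0 gives Δ = k(𝐫₁ - 𝐫₂). Taking both energies
  -- equal to -k makes μ𝐋₁ - μ𝐋₂ = Δ - k(𝐫₁ - 𝐫₂) vanish.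
  let u : Fin 2 → S := fun j => (1 / 2 : ℝ) •
    (vel (d j) (ρ j) (ρ' j) ⬝ᵥ vel (d j) (ρ j) (ρ' j)) + k
  have hE : ∀ j, energy (d j) (ρ j) (ρ' j) (u j) = -k := by
    intro j
    simp [energy, u]
  refine ⟨ρ', u, angMom_eq_of_qVal_eq_zero d ρ hK hq, ?_, by rw [hE, hE]⟩
  rw [← muLenz_sub_energy_smul_pos (d 0) _ _ (u 0), ← muLenz_sub_energy_smul_pos (d 1) _ _ (u 1),
    hE, hE, sub_sub_sub_comm, ← smul_sub, neg_smul, sub_neg_eq_add, add_eq_right] at hk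
  exact sub_eq_zero.mp hk

end Emb

/-! ### All these expressions commute with homomorphisms of ℝ-algebras. -/

section Functoriality

variable {S T : Type} [CommRing S] [Algebra ℝ S] [CommRing T] [Algebra ℝ T] (f : S →ₐ[ℝ] T)

theorem map_emb (v : Fin 3 → ℝ) (i : Fin 3) : f (emb S v i) = emb T v i := by
  simp [emb]

theorem map_pos (e : EpochData) (x : S) (i : Fin 3) : f (pos e x i) = pos e (f x) i := by
  simp [pos, map_emb]

theorem map_vel (e : EpochData) (x y : S) (i : Fin 3) :
    f (vel e x y i) = vel e (f x) (f y) i := by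
  simp [vel, map_emb]

theorem map_angMom (e : EpochData) (x y : S) (i : Fin 3) :
    f (angMom e x y i) = angMom e (f x) (f y) i := by
  fin_cases i <;> simp [angMom, cross_apply, map_pos, map_vel]

theorem map_muLenz (e : EpochData) (x y z : S) (i : Fin 3) :
    f (muLenz e x y z i) = muLenz e (f x) (f y) (f z) i := by
  simp [muLenz, dotProduct, map_pos, map_vel]

theorem map_energy (e : EpochData) (x y z : S) :
    f (energy e x y z) = energy e (f x) (f y) (f z) := by
  simp [energy, dotProduct, map_vel]

theorem map_xi (d : LinkData) (ρ ρ' u : Fin 2 → S) (i : Fin 3) :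
    f (xi d ρ ρ' u i) = xi d (f ∘ ρ) (f ∘ ρ') (f ∘ u) i := by
  fin_cases i <;> simp [xi, cross_apply, map_pos, map_muLenz, map_energy]

theorem map_vecJ (d : LinkData) (ρ : Fin 2 → S) (i : Fin 3) :
    f (vecJ d ρ i) = vecJ d (f ∘ ρ) i := by
  simp [vecJ, map_emb]

theorem map_qVal (d : LinkData) (ρ : Fin 2 → S) : f (qVal d ρ) = qVal d (f ∘ ρ) := by
  simp [qVal, dotProduct, map_emb, map_vecJ]

theorem map_rhoDotVal (d : LinkData) (ρ : Fin 2 → S) :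
    f ∘ rhoDotVal d ρ = rhoDotVal d (f ∘ ρ) := by
  ext i
  fin_cases i <;> simp [rhoDotVal, dotProduct, Fin.sum_univ_three, cross_apply, map_emb, map_vecJ]

theorem map_pVal (d : LinkData) (ρ : Fin 2 → S) (j : Fin 2) :
    f (pVal d ρ j) = pVal d (f ∘ ρ) j := by
  simp only [pVal, dotProduct, map_sum, map_mul, map_emb, map_xi, map_rhoDotVal]
  rw [xi_eq_xi d _ _ _ 0]

end Functoriality

open Polynomial

/-! ### Resultants with a quadratic polynomial as norms. -/

section QuadraticNorm

variable {R : Type*} [CommRing R]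

theorem resultant_linear_quadratic (A B a b c : R) :
    resultant (C A * X + C B) (C a * X ^ 2 + C b * X + C c) 1 2
      = a * B ^ 2 - b * A * B + c * A ^ 2 := by
  rw [resultant]
  change Matrix.det (n := Fin 3) _ = _
  rw [Matrix.det_fin_three]
  simp [sylvester, Fin.addCases, coeff_X, coeff_C]
  ring

/-- The resultant with a quadratic polynomial is, up to a unit, the norm of the residue class. -/
theorem exists_resultant_eq_mul_norm [IsDomain R] (p : R[X]) (b c a : R) (ha : IsUnit a) :
    ∃ k : R, IsUnit k ∧ resultant p (C a * (X ^ 2 - C b * X - C c))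
      = k * (aeval (QuadraticAlgebra.omega : QuadraticAlgebra R c b) p).norm := by
  have hmon : (X ^ 2 - C b * X - C c : R[X]).Monic := by
    monicity!
  have hdeg : (X ^ 2 - C b * X - C c : R[X]).natDegree = 2 := by
    compute_degree!
  have hform : C a * (X ^ 2 - C b * X - C c) = C a * X ^ 2 + C (-(a * b)) * X + C (-(a * c)) := by
    simp only [map_neg, map_mul]
    ring
  have hqdeg : (C a * (X ^ 2 - C b * X - C c)).natDegree = 2 := by
    rw [natDegree_C_mul ha.ne_zero, hdeg]
  set q0 : R[X] := X ^ 2 - C b * X - C c with hq0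
  have hkill : aeval (QuadraticAlgebra.omega : QuadraticAlgebra R c b) q0 = 0 := by
    ext <;> simp [hq0, sq, QuadraticAlgebra.omega]
  obtain ⟨A, B, hr⟩ : ∃ A B, p %ₘ q0 = C A * X + C B := by
    have h : (p %ₘ q0).natDegree ≤ 1 := by
      have := natDegree_modByMonic_lt p hmon (by intro h; simp [h] at hdeg)
      omega
    exact exists_eq_X_add_C_of_natDegree_le_one h
  have hp : p = (C A * X + C B) + q0 * (p /ₘ q0) := by
    rw [← hr, modByMonic_add_div p q0]
  have hval : aeval (QuadraticAlgebra.omega : QuadraticAlgebra R c b) p = ⟨B, A⟩ := by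
    rw [hp, map_add, map_mul, hkill]
    ext <;> simp [QuadraticAlgebra.omega]
  have hnorm : (aeval (QuadraticAlgebra.omega : QuadraticAlgebra R c b) p).norm
      = B * B + b * B * A - c * A * A := by
    rw [hval, QuadraticAlgebra.norm_def]
  have hlin : resultant (C A * X + C B) (C a * q0) 1 2 = a * (B * B + b * B * A - c * A * A) := by
    rw [hform, resultant_linear_quadratic]
    ring
  -- The resultant of the remainder is computed with formal degree 1, so a constant p is treated
  -- separately. Otherwise p is replaced by its remainder modulo the quadratic.
  rw [hnorm, hqdeg]
  by_cases h0 : p.natDegree = 0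
  · obtain ⟨r, rfl⟩ := natDegree_eq_zero.mp h0
    have : (⟨B, A⟩ : QuadraticAlgebra R c b) = ⟨r, 0⟩ := by
      rw [← hval]
      simp [QuadraticAlgebra.algebraMap_eq]
    rw [QuadraticAlgebra.mk.injEq] at this
    refine ⟨1, isUnit_one, ?_⟩
    rw [h0, resultant_C_zero_left, this.1, this.2]
    ring
  obtain ⟨k, hk⟩ : ∃ k, p.natDegree = 1 + k := ⟨p.natDegree - 1, by omega⟩
  -- Raising the formal degree of the remainder from 1 to deg p = 1 + k contributes a sign and the
  -- k-th power of the leading coefficient a. The last factor a comes from `hlin`.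
  refine ⟨(-1) ^ (2 * k) * (C a * q0).coeff 2 ^ k * a, ?_, ?_⟩
  · have : (C a * q0).coeff 2 = a := by
      rw [hform]
      simp
    rw [this]
    exact ((isUnit_one.neg.pow _).mul (ha.pow k)).mul ha
  rw [mul_assoc, ← hlin, ← resultant_add_left_deg _ _ _ _ _ natDegree_linear_le, ← hk]
  by_cases hs : p /ₘ q0 = 0
  · rw [hs, mul_zero, add_zero] at hp
    rw [← hp]
  obtain ⟨u, rfl⟩ := ha
  have hp2 : p = (C A * X + C B) + (C (u : R) * q0) * (C (↑u⁻¹ : R) * (p /ₘ q0)) := by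
    rw [mul_mul_mul_comm, ← C_mul, Units.mul_inv, C_1, one_mul]
    exact hp
  have hdiv := natDegree_divByMonic p hmon
  have hdeg2 : 2 ≤ p.natDegree := by
    by_contra hlt
    apply hs
    rw [divByMonic_eq_zero_iff hmon]
    exact degree_lt_degree (by omega)
  calc resultant p (C ↑u * q0) p.natDegree 2
      = resultant ((C A * X + C B) + (C (u : R) * q0) * (C (↑u⁻¹ : R) * (p /ₘ q0))) (C ↑u * q0)
          p.natDegree 2 := by rw [← hp2]
    _ = _ := by
      refine resultant_add_mul_left _ _ _ _ _ ?_ hqdeg.le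
      rw [natDegree_C_mul (Units.ne_zero _), hdiv, hdeg]
      omega

end QuadraticNorm

/-! ### The conic q = 0 and its coordinate ring. -/

/-- The coefficient of `ρ₁²` in `q`. -/
noncomputable def qA (d : LinkData) : ℝ := -(crossD d ⬝ᵥ (d 0).vecE)

/-- The coefficient of `ρ₁` in `q`. -/
noncomputable def qB (d : LinkData) : ℝ := -(crossD d ⬝ᵥ (d 0).vecF)

/-- The coefficient of `ρ₂²` in `q`. -/
noncomputable def qC2 (d : LinkData) : ℝ := crossD d ⬝ᵥ (d 1).vecE

/-- The coefficient of `ρ₂` in `q`. -/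
noncomputable def qC1 (d : LinkData) : ℝ := crossD d ⬝ᵥ (d 1).vecF

/-- The constant term of `q`. -/
noncomputable def qC0 (d : LinkData) : ℝ := crossD d ⬝ᵥ (d 1).vecG - crossD d ⬝ᵥ (d 0).vecG

/-- The coefficient of `ρ` in `𝐜 · 𝐞^ρ`. -/
noncomputable def losF (e : EpochData) : ℝ := e.vecF ⬝ᵥ e.los

/-- The constant term of `𝐜 · 𝐞^ρ`. -/
noncomputable def losG (e : EpochData) : ℝ := e.vecG ⬝ᵥ e.los

theorem qVal_eq {S : Type} [CommRing S] [Algebra ℝ S] (d : LinkData) (ρ : Fin 2 → S) :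
    qVal d ρ = algebraMap ℝ S (qA d) * ρ 0 ^ 2 + algebraMap ℝ S (qB d) * ρ 0
      + (algebraMap ℝ S (qC2 d) * ρ 1 ^ 2 + algebraMap ℝ S (qC1 d) * ρ 1
        + algebraMap ℝ S (qC0 d)) := by
  simp only [qVal, vecJ, dotProduct_add, dotProduct_sub, dotProduct_smul, emb_dot, qA, qB, qC2,
    qC1, qC0, smul_eq_mul, map_neg, map_sub]
  ring

/-- The point of the conic `q = 0` at which `𝐜₁ · 𝐞^ρ₁ = 0` and `𝐜₂ · 𝐞^ρ₂ = 0`. -/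
theorem qVal_eq_zero_of_losF (d : LinkData) (r : Fin 2 → ℝ)
    (h : ∀ j, losF (d j) * r j + losG (d j) = 0) : qVal d r = 0 := by
  -- Here 𝐜 is orthogonal to 𝐫 always and to 𝐞^ρ by assumption. Since 𝐃 = 𝐫 × 𝐞^ρ, the triple
  -- product of 𝐃, v and 𝐜 expands into terms each containing one of these two scalar products.
  have key : ∀ (e : EpochData) (x : ℝ), losF e * x + losG e = 0 → ∀ v : Fin 3 → ℝ,
      (e.vecD ⨯₃ v) ⬝ᵥ angMom e x 0 = 0 := by
    intro e x hx v
    have h1 : angMom e x 0 ⬝ᵥ e.los = 0 := by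
      have := angMom_dot_los e x (0 : ℝ)
      rw [show emb ℝ e.los = e.los from rfl] at this
      rw [this]
      exact hx
    have h2 : pos e x ⬝ᵥ angMom e x 0 = 0 := dot_self_cross _ _
    have h3 : e.vecD = pos e x ⨯₃ e.los := by
      rw [pos, show emb ℝ e.los = e.los from rfl, show emb ℝ e.obsPos = e.obsPos from rfl]
      simp [EpochData.vecD]
    rw [h3]
    generalize angMom e x 0 = c at *
    have : ((pos e x ⨯₃ e.los) ⨯₃ v) ⬝ᵥ c
        = (pos e x ⬝ᵥ v) * (c ⬝ᵥ e.los) - (e.los ⬝ᵥ v) * (pos e x ⬝ᵥ c) := by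
      simp [cross_apply, dotProduct, Fin.sum_univ_three]
      ring
    rw [this, h1, h2]
    ring
  -- 𝐉 does not involve the radial velocities, so they may be set to zero.
  have hJ : vecJ d r = angMom (d 1) (r 1) 0 - angMom (d 0) (r 0) 0 := by
    have := angMom_sub_angMom d r 0
    simp only [Pi.zero_apply, zero_smul, sub_zero, zero_sub] at this
    rw [← neg_sub, this, neg_neg]
  have e0 := key (d 0) (r 0) (h 0) (d 1).vecD
  have e1 := key (d 1) (r 1) (h 1) (d 0).vecD
  rw [qVal, hJ, dotProduct_sub, show emb ℝ (crossD d) = crossD d from rfl, crossD, e0, sub_zero,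
    ← cross_anticomm, neg_dotProduct, e1, neg_zero]

/-- `-c(ρ₂) / a`, where `q = a ρ₁² + b ρ₁ + c(ρ₂)`. -/
noncomputable def conicRe (d : LinkData) : ℝ[X] :=
  C (-(qC2 d / qA d)) * X ^ 2 + C (-(qC1 d / qA d)) * X + C (-(qC0 d / qA d))

/-- `-b / a`, where `q = a ρ₁² + b ρ₁ + c(ρ₂)`. -/
noncomputable def conicIm (d : LinkData) : ℝ[X] := C (-(qB d / qA d))

/-- The coordinate ring `ℝ[ρ₁, ρ₂]/(q)`, free of rank two over `ℝ[ρ₂]`. -/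
abbrev Conic (d : LinkData) : Type := QuadraticAlgebra ℝ[X] (conicRe d) (conicIm d)

/-- The residue classes of `ρ₁, ρ₂` modulo `q`. -/
noncomputable def conicPt (d : LinkData) : Fin 2 → Conic d :=
  ![QuadraticAlgebra.omega, algebraMap ℝ[X] (Conic d) X]

/-- The residue class of `pⱼ` modulo `q`. -/
noncomputable def conicP (d : LinkData) (j : Fin 2) : Conic d := pVal d (conicPt d) j

theorem algebraMap_conic (d : LinkData) (r : ℝ) : algebraMap ℝ (Conic d) r = ⟨C r, 0⟩ := rfl

theorem conicPt_zero (d : LinkData) : conicPt d 0 = ⟨0, 1⟩ := rfl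

theorem conicPt_one (d : LinkData) : conicPt d 1 = ⟨X, 0⟩ := rfl

theorem qVal_conicPt (d : LinkData) (ha : qA d ≠ 0) : qVal d (conicPt d) = 0 := by
  rw [qVal_eq]
  have e (r : ℝ) : (C (qA d) * C (r / qA d) : ℝ[X]) = C r := by
    rw [← C_mul, mul_div_cancel₀ _ ha]
  rw [conicPt_zero, conicPt_one]
  ext1
  · simp only [algebraMap_conic, sq, QuadraticAlgebra.re_add, QuadraticAlgebra.re_mul,
      QuadraticAlgebra.im_mul, QuadraticAlgebra.re_zero]
    simp only [conicRe, map_neg]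
    linear_combination (-X ^ 2) * e (qC2 d) - X * e (qC1 d) - e (qC0 d)
  · simp only [algebraMap_conic, sq, QuadraticAlgebra.im_add, QuadraticAlgebra.re_mul,
      QuadraticAlgebra.im_mul, QuadraticAlgebra.im_zero]
    simp only [conicIm, map_neg]
    linear_combination -e (qB d)

/-- Reduction modulo `q`. -/
noncomputable def conicHom (d : LinkData) : ℝ[X][X] →ₐ[ℝ] Conic d :=
  (aeval (QuadraticAlgebra.omega : Conic d) : ℝ[X][X] →ₐ[ℝ[X]] Conic d).restrictScalars ℝ

theorem conicHom_comp_rhoVar (d : LinkData) : conicHom d ∘ rhoVar = conicPt d := by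
  ext1 i
  fin_cases i <;> simp [conicHom, rhoVar, conicPt]

theorem conicHom_pPoly (d : LinkData) (j : Fin 2) : conicHom d (pPoly d j) = conicP d j := by
  rw [pPoly_eq, map_pVal, conicHom_comp_rhoVar, conicP]

theorem qPoly_eq_quadratic (d : LinkData) (ha : qA d ≠ 0) :
    qPoly d = C (C (qA d)) * (X ^ 2 - C (conicIm d) * X - C (conicRe d)) := by
  have e (r : ℝ) : (C (C (qA d)) * C (C (r / qA d)) : ℝ[X][X]) = C (C r) := by
    rw [← C_mul, ← C_mul, mul_div_cancel₀ _ ha]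
  have ealg (r : ℝ) : algebraMap ℝ ℝ[X][X] r = C (C r) := rfl
  rw [qPoly_eq, qVal_eq]
  simp only [rhoVar, ealg, conicRe, conicIm, map_neg, map_add, map_mul, map_pow,
    Matrix.cons_val_zero, Matrix.cons_val_one, Matrix.cons_val_fin_one]
  linear_combination (-C X ^ 2) * e (qC2 d) - C X * e (qC1 d) - e (qC0 d) - X * e (qB d)

theorem exists_uRes_eq (d : LinkData) (ha : qA d ≠ 0) (j : Fin 2) :
    ∃ k : ℝ[X], IsUnit k ∧ uRes d j = k * (conicP d j).norm := by
  obtain ⟨k, hk, h⟩ := exists_resultant_eq_mul_norm (pPoly d j) (conicIm d) (conicRe d)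
    (C (qA d)) ((IsUnit.mk0 _ ha).map C)
  refine ⟨k, hk, ?_⟩
  rw [uRes, qPoly_eq_quadratic d ha, h, ← conicHom_pPoly]
  rfl

theorem natDegree_qPoly (d : LinkData) (ha : qA d ≠ 0) : (qPoly d).natDegree = 2 := by
  have hdeg : (X ^ 2 - C (conicIm d) * X - C (conicRe d) : ℝ[X][X]).natDegree = 2 := by
    compute_degree!
  rw [qPoly_eq_quadratic d ha, natDegree_C_mul (C_ne_zero.mpr ha), hdeg]

/-! ### Comparison of the norms of p₁ and p₂, and their common factor. -/

/-- The value of `ρ₂` at which `𝐜₂ · 𝐞^ρ₂ = 0`. -/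
noncomputable def rootTwo (d : LinkData) : ℝ := -(losG (d 1) / losF (d 1))

/-- The second value of `ρ₂` on the conic `q = 0` with the value of `ρ₁` at which
`𝐜₁ · 𝐞^ρ₁ = 0`. -/
noncomputable def rootOne (d : LinkData) : ℝ := -(qC1 d / qC2 d) - rootTwo d

/-- `𝐜₁ · 𝐞^ρ₁` modulo `q`. -/
noncomputable def conicL (d : LinkData) : Conic d :=
  algebraMap ℝ (Conic d) (losF (d 0)) * conicPt d 0 + algebraMap ℝ (Conic d) (losG (d 0))

/-- With F, G the coefficients of 𝐜₁ · 𝐞^ρ₁, the norm of Fρ₁ + G is (F²/a) q(-G/F, ρ₂), a quadratic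
in ρ₂. One root is `rootTwo` by `qVal_eq_zero_of_losF`, and Vieta gives the other. -/
theorem norm_conicL (d : LinkData) (ha : qA d ≠ 0) (hc : qC2 d ≠ 0) (h0 : losF (d 0) ≠ 0)
    (h1 : losF (d 1) ≠ 0) :
    (conicL d).norm = C (losF (d 0) ^ 2 * qC2 d / qA d)
      * ((X - C (rootTwo d)) * (X - C (rootOne d))) := by
  have hq := qVal_eq_zero_of_losF d ![-(losG (d 0) / losF (d 0)), rootTwo d] (by
    intro j
    fin_cases j
    · simp; field_simp; ring
    · simp [rootTwo]; field_simp; ring)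
  rw [qVal_eq] at hq
  simp only [Algebra.algebraMap_self, RingHom.id_apply, Matrix.cons_val_zero, Matrix.cons_val_one,
    Matrix.cons_val_fin_one] at hq
  have hL : conicL d = ⟨C (losG (d 0)), C (losF (d 0))⟩ := by
    ext1 <;> simp [conicL, conicPt, algebraMap_conic, QuadraticAlgebra.omega]
  rw [hL, QuadraticAlgebra.norm_def]
  have hs : rootOne d + rootTwo d = -(qC1 d / qC2 d) := by simp [rootOne]
  have hprod : qC2 d * (rootOne d * rootTwo d) = qA d * (losG (d 0) / losF (d 0)) ^ 2
      - qB d * (losG (d 0) / losF (d 0)) + qC0 d := by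
    have : qC2 d * (rootOne d + rootTwo d) = -qC1 d := by rw [hs]; field_simp
    linear_combination rootTwo d * this - hq
  have e1 : losF (d 0) ^ 2 * qC2 d / qA d * (rootOne d + rootTwo d)
      = -(losF (d 0) ^ 2 * (qC1 d / qA d)) := by
    rw [hs]; field_simp
  have e2 : losF (d 0) ^ 2 * qC2 d / qA d * (rootOne d * rootTwo d)
      = losG (d 0) ^ 2 - qB d / qA d * losG (d 0) * losF (d 0)
        + losF (d 0) ^ 2 * (qC0 d / qA d) := by
    have : losF (d 0) ^ 2 * qC2 d / qA d * (rootOne d * rootTwo d)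
      = losF (d 0) ^ 2 / qA d * (qC2 d * (rootOne d * rootTwo d)) := by ring
    rw [this, hprod]
    field_simp
  have e1' := congrArg (C : ℝ →+* ℝ[X]) e1
  have e2' := congrArg (C : ℝ →+* ℝ[X]) e2
  have e3 : (C (losF (d 0) ^ 2 * qC2 d / qA d) : ℝ[X]) = C (losF (d 0)) ^ 2 * C (qC2 d / qA d) := by
    rw [← C_pow, ← C_mul]
    ring_nf
  simp only [map_add, map_sub, map_neg, map_mul, map_pow] at e1' e2'
  simp only [conicRe, conicIm, map_neg]
  linear_combination X * e1' - e2' - X ^ 2 * e3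

/-- Take norms in `pVal_mul_eq`. The form 𝐜₂ · 𝐞^ρ₂ lies in ℝ[ρ₂], so its norm is its square, and
one of the two factors X - `rootTwo` cancels against the norm of 𝐜₁ · 𝐞^ρ₁. -/
theorem norm_conicP_eq (d : LinkData) (hK : crossD d ⬝ᵥ crossD d ≠ 0) (ha : qA d ≠ 0)
    (hc : qC2 d ≠ 0) (h0 : losF (d 0) ≠ 0) (h1 : losF (d 1) ≠ 0) :
    ∃ κ : ℝ, κ ≠ 0 ∧ (conicP d 0).norm * (X - C (rootTwo d))
      = C κ * (conicP d 1).norm * (X - C (rootOne d)) := by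
  refine ⟨losF (d 0) ^ 2 * qC2 d / qA d / losF (d 1) ^ 2, by positivity, ?_⟩
  have hm : conicP d 0 * algebraMap ℝ[X] (Conic d) (C (losF (d 1)) * (X - C (rootTwo d)))
      = conicP d 1 * conicL d := by
    rw [conicP, conicP, conicL]
    refine Eq.trans ?_ (pVal_mul_eq d (conicPt d) hK (qVal_conicPt d ha))
    congr 1
    have e : C (losF (d 1)) * (X - C (rootTwo d)) = C (losF (d 1)) * X + C (losG (d 1)) := by
      rw [mul_sub, ← C_mul, sub_eq_add_neg, ← C_neg]
      congr 2
      rw [rootTwo]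
      field_simp
    rw [e, map_add, map_mul]
    rfl
  have hn := congrArg QuadraticAlgebra.norm hm
  rw [map_mul, QuadraticAlgebra.norm_algebraMap, map_mul, norm_conicL d ha hc h0 h1] at hn
  have hne : C (losF (d 1)) ^ 2 * (X - C (rootTwo d)) ≠ 0 :=
    mul_ne_zero (pow_ne_zero _ (C_ne_zero.mpr h1)) (X_sub_C_ne_zero _)
  apply mul_left_cancel₀ hne
  have e : (C (losF (d 1)) ^ 2 * C (losF (d 0) ^ 2 * qC2 d / qA d / losF (d 1) ^ 2) : ℝ[X])
      = C (losF (d 0) ^ 2 * qC2 d / qA d) := by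
    rw [← C_pow, ← C_mul]
    congr 1
    field_simp
  linear_combination hn - (X - C (rootTwo d)) * (X - C (rootOne d)) * (conicP d 1).norm * e

/-- The common factor of the norms of `p₁` and `p₂`. -/
theorem exists_common_factor (d : LinkData) (hK : crossD d ⬝ᵥ crossD d ≠ 0) (ha : qA d ≠ 0)
    (hc : qC2 d ≠ 0) (h0 : losF (d 0) ≠ 0) (h1 : losF (d 1) ≠ 0) (hs : rootOne d ≠ rootTwo d) :
    ∃ h : ℝ[X], (conicP d 0).norm = (X - C (rootOne d)) * h ∧ Associated (uPoly d) h := by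
  obtain ⟨κ, hκ, e⟩ := norm_conicP_eq d hK ha hc h0 h1
  obtain ⟨k0, hk0, e0⟩ := exists_uRes_eq d ha 0
  obtain ⟨k1, hk1, e1⟩ := exists_uRes_eq d ha 1
  have hcop : IsCoprime (X - C (rootOne d)) (X - C (rootTwo d)) :=
    isCoprime_X_sub_C_of_isUnit_sub ((IsUnit.mk0 _ (sub_ne_zero.mpr hs)))
  obtain ⟨h, hh⟩ : X - C (rootOne d) ∣ (conicP d 0).norm :=
    hcop.dvd_of_dvd_mul_right (Dvd.intro_left _ e.symm)
  have hh1 : C κ * (conicP d 1).norm = (X - C (rootTwo d)) * h := by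
    apply mul_right_cancel₀ (X_sub_C_ne_zero (rootOne d))
    rw [← e, hh]
    ring
  have hκu : IsUnit (C κ : ℝ[X]) := (IsUnit.mk0 _ hκ).map C
  refine ⟨h, hh, associated_of_dvd_dvd ?_ ?_⟩
  · have d0 : uPoly d ∣ (X - C (rootOne d)) * h := by
      rw [← hh]
      refine (EuclideanDomain.gcd_dvd_left _ _).trans ?_
      rw [e0]
      exact (hk0.mul_left_dvd).mpr dvd_rfl
    have d1 : uPoly d ∣ (X - C (rootTwo d)) * h := by
      rw [← hh1]
      refine (EuclideanDomain.gcd_dvd_right _ _).trans ?_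
      rw [e1]
      exact (hk1.mul_left_dvd).mpr (dvd_mul_left _ _)
    obtain ⟨a, b, hab⟩ := hcop
    -- A common divisor of (X - r₁)h and (X - r₂)h divides h, by the Bézout relation between the two
    -- linear factors.
    have : h = a * ((X - C (rootOne d)) * h) + b * ((X - C (rootTwo d)) * h) := by
      linear_combination (-h) * hab
    rw [this]
    exact dvd_add (d0.mul_left _) (d1.mul_left _)
  · refine EuclideanDomain.dvd_gcd ?_ ?_
    · rw [e0, hh]
      exact (dvd_mul_left _ _).mul_left _
    · have : h ∣ C κ * (conicP d 1).norm := by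
        rw [hh1]
        exact dvd_mul_left _ _
      rw [e1]
      exact (hκu.dvd_mul_left.mp this).mul_left _

/-! ### The bound 5 for the degree of p₁ in a filtered ring. -/

section Filtration

variable {S : Type} [CommRing S]

/-- An increasing sequence of additive subgroups that is compatible with the multiplication. -/
structure IsDegreeFiltration (F : ℕ → AddSubgroup S) : Prop where
  mono : Monotone F
  mul_mem : ∀ {n m : ℕ} {x y : S}, x ∈ F n → y ∈ F m → x * y ∈ F (n + m)

/-- The vectors all of whose components lie in a given subgroup. -/
def vecSubgroup (G : AddSubgroup S) : AddSubgroup (Fin 3 → S) := AddSubgroup.pi Set.univ fun _ => G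

theorem mem_vecSubgroup {G : AddSubgroup S} {v : Fin 3 → S} :
    v ∈ vecSubgroup G ↔ ∀ i, v i ∈ G := by
  simp [vecSubgroup, AddSubgroup.mem_pi]

namespace IsDegreeFiltration

variable {F : ℕ → AddSubgroup S} (hF : IsDegreeFiltration F)
include hF

theorem mem_of_le {n m : ℕ} (hnm : n ≤ m) {x : S} (hx : x ∈ F n) : x ∈ F m := hF.mono hnm hx

theorem vec_mem_of_le {n m : ℕ} (hnm : n ≤ m) {v : Fin 3 → S} (hv : v ∈ vecSubgroup (F n)) :
    v ∈ vecSubgroup (F m) :=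
  mem_vecSubgroup.mpr fun i => hF.mono hnm (mem_vecSubgroup.mp hv i)

theorem smul_mem {n m : ℕ} {x : S} {v : Fin 3 → S} (hx : x ∈ F n) (hv : v ∈ vecSubgroup (F m)) :
    x • v ∈ vecSubgroup (F (n + m)) :=
  mem_vecSubgroup.mpr fun i => hF.mul_mem hx (mem_vecSubgroup.mp hv i)

theorem dot_mem {n m : ℕ} {v w : Fin 3 → S} (hv : v ∈ vecSubgroup (F n))
    (hw : w ∈ vecSubgroup (F m)) : v ⬝ᵥ w ∈ F (n + m) :=
  AddSubgroup.sum_mem _ fun i _ => hF.mul_mem (mem_vecSubgroup.mp hv i) (mem_vecSubgroup.mp hw i)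

theorem cross_mem {n m : ℕ} {v w : Fin 3 → S} (hv : v ∈ vecSubgroup (F n))
    (hw : w ∈ vecSubgroup (F m)) : v ⨯₃ w ∈ vecSubgroup (F (n + m)) := by
  rw [mem_vecSubgroup] at *
  intro i
  rw [cross_apply]
  fin_cases i
  · exact sub_mem (hF.mul_mem (hv 1) (hw 2)) (hF.mul_mem (hv 2) (hw 1))
  · exact sub_mem (hF.mul_mem (hv 2) (hw 0)) (hF.mul_mem (hv 0) (hw 2))
  · exact sub_mem (hF.mul_mem (hv 0) (hw 1)) (hF.mul_mem (hv 1) (hw 0))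

/-- With ρ in degree 1 and ρ̇ in degree 2, the expression looks as if it had degree 6. In the
expansion `cross_lenzRest_dot` the components along e have dropped out, and each of the four
remaining terms has degree at most 5. The last one needs the sharper bound 2 for v × r. -/
theorem cross_lenzRest_dot_mem {h s s' : S} {e q w r v : Fin 3 → S}
    (hh : h ∈ F 0) (hs : s ∈ F 1) (hs' : s' ∈ F 2) (he : e ∈ vecSubgroup (F 0))
    (hq : q ∈ vecSubgroup (F 0)) (hw : w ∈ vecSubgroup (F 1)) (hr : r ∈ vecSubgroup (F 1))
    (hv : v ∈ vecSubgroup (F 2)) (hvr : v ⨯₃ r ∈ vecSubgroup (F 2)) :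
    ((lenzRest h (s • e + q) (s' • e + w) - lenzRest h r v) ⨯₃ (s • e + q - r)) ⬝ᵥ e ∈ F 5 := by
  have hpos : s • e + q ∈ vecSubgroup (F 1) :=
    add_mem (hF.smul_mem hs he) (hF.vec_mem_of_le zero_le_one hq)
  have hvel : s' • e + w ∈ vecSubgroup (F 2) :=
    add_mem (hF.smul_mem hs' he) (hF.vec_mem_of_le one_le_two hw)
  have hm : (s • e + q) ⬝ᵥ (s' • e + w) ∈ F 3 := hF.dot_mem hpos hvel
  have hlenz : lenzRest h r v ∈ vecSubgroup (F 5) :=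
    sub_mem (hF.smul_mem (hF.mul_mem hh (hF.dot_mem hv hv)) hr)
      (hF.smul_mem (hF.dot_mem hr hv) hv)
  have h1 : (h * ((s' • e + w) ⬝ᵥ (s' • e + w))) • q ∈ vecSubgroup (F 4) :=
    hF.smul_mem (hF.mul_mem hh (hF.dot_mem hvel hvel)) hq
  have h2 : ((s • e + q) ⬝ᵥ (s' • e + w)) • w ∈ vecSubgroup (F 4) := hF.smul_mem hm hw
  rw [cross_lenzRest_dot]
  refine sub_mem (sub_mem (sub_mem (neg_mem ?_) ?_) ?_) ?_
  · exact hF.mem_of_le (by norm_num) (hF.mul_mem hm (hF.dot_mem (hF.cross_mem hw hq) he))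
  · exact hF.dot_mem (hF.cross_mem (sub_mem h1 h2) hr) he
  · exact hF.dot_mem (hF.cross_mem hlenz hq) he
  · exact hF.mul_mem (hF.dot_mem hr hv) (hF.dot_mem hvr he)

variable [Algebra ℝ S] (hC : ∀ c : ℝ, algebraMap ℝ S c ∈ F 0) (d : LinkData) {ρ : Fin 2 → S}
  (hρ : ∀ j, ρ j ∈ F 1)
include hC

omit hF in
theorem emb_mem (v : Fin 3 → ℝ) : emb S v ∈ vecSubgroup (F 0) :=
  mem_vecSubgroup.mpr fun i => hC (v i)

include hρ

theorem vecJ_mem : vecJ d ρ ∈ vecSubgroup (F 2) := by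
  have h (j : Fin 2) : ρ j ^ 2 ∈ F 2 := by
    rw [sq]
    exact hF.mul_mem (hρ j) (hρ j)
  have h' (j : Fin 2) : ρ j ∈ F 2 := hF.mem_of_le one_le_two (hρ j)
  have e (v : Fin 3 → ℝ) : emb S v ∈ vecSubgroup (F 0) := emb_mem hC v
  have e2 (v : Fin 3 → ℝ) : emb S v ∈ vecSubgroup (F 2) := hF.vec_mem_of_le zero_le_two (e v)
  exact sub_mem (add_mem (sub_mem (add_mem (sub_mem (hF.smul_mem (h 1) (e _))
    (hF.smul_mem (h 0) (e _))) (hF.smul_mem (h' 1) (e _))) (hF.smul_mem (h' 0) (e _)))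
    (e2 _)) (e2 _)

theorem rhoDotVal_mem (j : Fin 2) : rhoDotVal d ρ j ∈ F 2 := by
  have key (v w : Fin 3 → ℝ) (c : ℝ) : c • ((vecJ d ρ ⨯₃ emb S v) ⬝ᵥ emb S w) ∈ F 2 := by
    rw [Algebra.smul_def, ← zero_add 2]
    exact hF.mul_mem (hC c) (hF.dot_mem (hF.cross_mem (hF.vecJ_mem hC d hρ) (emb_mem hC v))
      (emb_mem hC w))
  fin_cases j
  · exact key _ _ _
  · exact key _ _ _

/-- `p₁` has total degree at most `5`. -/
theorem pVal_zero_mem : pVal d ρ 0 ∈ F 5 := by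
  have hd := hF.rhoDotVal_mem hC d hρ
  have e (v : Fin 3 → ℝ) : emb S v ∈ vecSubgroup (F 0) := emb_mem hC v
  have e1 (v : Fin 3 → ℝ) : emb S v ∈ vecSubgroup (F 1) := hF.vec_mem_of_le zero_le_one (e v)
  have hw (j : Fin 2) : ρ j • emb S (d j).eta + emb S (d j).obsVel ∈ vecSubgroup (F 1) :=
    add_mem (hF.smul_mem (hρ j) (e _)) (e1 _)
  have hpos (j : Fin 2) : pos (d j) (ρ j) ∈ vecSubgroup (F 1) :=
    add_mem (hF.smul_mem (hρ j) (e _)) (e1 _)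
  have hvel (j : Fin 2) : vel (d j) (ρ j) (rhoDotVal d ρ j)
      = rhoDotVal d ρ j • emb S (d j).los + (ρ j • emb S (d j).eta + emb S (d j).obsVel) :=
    add_assoc _ _ _
  have hv : vel (d 1) (ρ 1) (rhoDotVal d ρ 1) ∈ vecSubgroup (F 2) := by
    rw [hvel]
    exact add_mem (hF.smul_mem (hd 1) (e _)) (hF.vec_mem_of_le one_le_two (hw 1))
  -- The term ρ̇ρ 𝐞^ρ × 𝐞^ρ of degree 3 vanishes.
  have hcross : vel (d 1) (ρ 1) (rhoDotVal d ρ 1) ⨯₃ pos (d 1) (ρ 1) ∈ vecSubgroup (F 2) := by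
    have hexp : vel (d 1) (ρ 1) (rhoDotVal d ρ 1) ⨯₃ pos (d 1) (ρ 1)
        = rhoDotVal d ρ 1 • (emb S (d 1).los ⨯₃ emb S (d 1).obsPos)
          + (ρ 1 • emb S (d 1).eta + emb S (d 1).obsVel) ⨯₃ pos (d 1) (ρ 1) := by
      rw [hvel, map_add, LinearMap.add_apply, map_smul, LinearMap.smul_apply]
      congr 2
      rw [pos, map_add, map_smul, cross_self, smul_zero, zero_add]
    rw [hexp]
    exact add_mem (hF.smul_mem (hd 1) (hF.cross_mem (e _) (e _))) (hF.cross_mem (hw 1) (hpos 1))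
  have key := hF.cross_lenzRest_dot_mem (hC (1 / 2)) (hρ 0) (hd 0) (e (d 0).los)
    (e (d 0).obsPos) (hw 0) (hpos 1) hv hcross
  rw [← hvel, ← pos] at key
  rw [pVal, xi_eq_lenzRest]
  exact key

end IsDegreeFiltration

end Filtration

/-! ### Total degree on the conic. -/

section Degree

variable {d : LinkData}

/-- The residue class `z` of a polynomial in `ρ₁, ρ₂` modulo `q` has total degree at most `n`. -/
def DegLE (n : ℕ) (z : Conic d) : Prop := z.re.degree ≤ n ∧ z.im.degree + 1 ≤ n

theorem degree_conicRe_le (d : LinkData) : (conicRe d).degree ≤ 2 := degree_quadratic_le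

theorem degree_conicIm_le (d : LinkData) : (conicIm d).degree ≤ 0 := degree_C_le

theorem DegLE.mono {n m : ℕ} {z : Conic d} (h : DegLE n z) (hnm : n ≤ m) : DegLE m z := by
  have : (n : WithBot ℕ) ≤ m := by exact_mod_cast hnm
  exact ⟨h.1.trans this, h.2.trans this⟩

theorem DegLE.add {n : ℕ} {z w : Conic d} (hz : DegLE n z) (hw : DegLE n w) :
    DegLE n (z + w) := by
  refine ⟨(degree_add_le _ _).trans (max_le hz.1 hw.1), ?_⟩
  refine (add_le_add_left (degree_add_le _ _) 1).trans ?_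
  rw [max_add]
  exact max_le hz.2 hw.2

theorem DegLE.neg {n : ℕ} {z : Conic d} (hz : DegLE n z) : DegLE n (-z) := by
  refine ⟨?_, ?_⟩
  · rw [QuadraticAlgebra.re_neg, degree_neg]
    exact hz.1
  · rw [QuadraticAlgebra.im_neg, degree_neg]
    exact hz.2

/-- Reduction by q does not raise the total degree: ρ₁² is replaced by `conicRe` + `conicIm` · ρ₁,
where `conicRe` has degree at most 2 and `conicIm` is constant. -/
theorem DegLE.mul {n m : ℕ} {z w : Conic d} (hz : DegLE n z) (hw : DegLE m w) :
    DegLE (n + m) (z * w) := by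
  have hb := degree_conicIm_le d
  have ha := degree_conicRe_le d
  have hone : (0 : WithBot ℕ) ≤ 1 := zero_le_one
  refine ⟨?_, ?_⟩
  · rw [QuadraticAlgebra.re_mul]
    refine (degree_add_le _ _).trans (max_le ?_ ?_)
    · refine (degree_mul_le _ _).trans ?_
      push_cast
      exact add_le_add hz.1 hw.1
    · refine (degree_mul_le _ _).trans ((add_le_add_left (degree_mul_le _ _) _).trans ?_)
      calc _ ≤ 2 + z.im.degree + w.im.degree := by gcongr
        _ = (z.im.degree + 1) + (w.im.degree + 1) := by rw [← one_add_one_eq_two]; abel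
        _ ≤ _ := by
          push_cast
          exact add_le_add hz.2 hw.2
  · rw [QuadraticAlgebra.im_mul]
    refine (add_le_add_left (degree_add_le _ _) 1).trans ?_
    rw [max_add]
    refine max_le ?_ ?_
    · refine (add_le_add_left (degree_add_le _ _) 1).trans ?_
      rw [max_add]
      refine max_le ?_ ?_
      · refine (add_le_add_left (degree_mul_le _ _) 1).trans ?_
        rw [add_assoc]
        push_cast
        exact add_le_add hz.1 hw.2
      · refine (add_le_add_left (degree_mul_le _ _) 1).trans ?_
        rw [add_right_comm]
        push_cast
        exact add_le_add hz.2 hw.1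
    · refine (add_le_add_left ((degree_mul_le _ _).trans
        (add_le_add_left (degree_mul_le _ _) _)) 1).trans ?_
      calc _ ≤ 0 + z.im.degree + w.im.degree + 1 := by gcongr
        _ ≤ (0 + z.im.degree + w.im.degree + 1) + 1 := le_add_of_nonneg_right hone
        _ = (z.im.degree + 1) + (w.im.degree + 1) := by abel
        _ ≤ _ := by
          push_cast
          exact add_le_add hz.2 hw.2

/-- Index 0 is possible because the zero polynomial has degree ⊥, and ⊥ + 1 = ⊥ ≤ 0. -/
theorem DegLE.algebraMap (r : ℝ) : DegLE 0 (algebraMap ℝ (Conic d) r) := by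
  rw [algebraMap_conic]
  exact ⟨degree_C_le, by simp⟩

theorem degLE_conicPt (j : Fin 2) : DegLE 1 (conicPt d j) := by
  fin_cases j
  · exact ⟨by simp [conicPt_zero], by simp [conicPt_zero]⟩
  · exact ⟨by simp [conicPt_one], by simp [conicPt_one]⟩

theorem DegLE.degree_norm_le {n : ℕ} {z : Conic d} (hz : DegLE n z) :
    z.norm.degree ≤ (n + n : ℕ) := by
  have hb := degree_conicIm_le d
  have ha := degree_conicRe_le d
  have him : z.im.degree ≤ n := (le_add_of_nonneg_right zero_le_one).trans hz.2
  push_cast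
  rw [QuadraticAlgebra.norm_def]
  refine (degree_sub_le _ _).trans (max_le ((degree_add_le _ _).trans (max_le ?_ ?_)) ?_)
  · exact (degree_mul_le _ _).trans (add_le_add hz.1 hz.1)
  · refine (degree_mul_le _ _).trans (add_le_add ((degree_mul_le _ _).trans ?_) him)
    calc _ ≤ (0 : WithBot ℕ) + n := add_le_add hb hz.1
      _ = n := zero_add _
  · refine (degree_mul_le _ _).trans ((add_le_add_left (degree_mul_le _ _) _).trans ?_)
    calc _ ≤ 2 + z.im.degree + z.im.degree := by gcongr
      _ = (z.im.degree + 1) + (z.im.degree + 1) := by rw [← one_add_one_eq_two]; abel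
      _ ≤ _ := add_le_add hz.2 hz.2

/-- The filtration of `ℝ[ρ₁, ρ₂]/(q)` by the total degree. -/
noncomputable def conicFiltration (d : LinkData) (n : ℕ) : AddSubgroup (Conic d) where
  carrier := {z | DegLE n z}
  add_mem' := DegLE.add
  zero_mem' := ⟨by simp, by simp⟩
  neg_mem' := DegLE.neg

theorem isDegreeFiltration_conicFiltration (d : LinkData) :
    IsDegreeFiltration (conicFiltration d) :=
  ⟨fun _ _ hnm _ hz => DegLE.mono hz hnm, DegLE.mul⟩

theorem degLE_conicP_zero : DegLE 5 (conicP d 0) :=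
  (isDegreeFiltration_conicFiltration d).pVal_zero_mem DegLE.algebraMap d degLE_conicPt

end Degree

/-! ### The polynomial 𝔲 lies in the ideal I. -/

section Membership

/-- Evaluation of a polynomial in `ρ₁, ρ₂`. -/
noncomputable def evalRho {T : Type} [CommRing T] [Algebra ℝ T] (ρ : Fin 2 → T) :
    ℝ[X][X] →ₐ[ℝ] T where
  toRingHom := eval₂RingHom (aeval (ρ 1) : ℝ[X] →ₐ[ℝ] T).toRingHom (ρ 0)
  commutes' r := by
    change eval₂RingHom _ _ (C (C r)) = _
    simp

theorem evalRho_comp_rhoVar {T : Type} [CommRing T] [Algebra ℝ T] (ρ : Fin 2 → T) :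
    evalRho ρ ∘ rhoVar = ρ := by
  ext1 i
  fin_cases i <;> simp [evalRho, rhoVar]

theorem evalRho_C {T : Type} [CommRing T] [Algebra ℝ T] (ρ : Fin 2 → T) (g : ℝ[X]) :
    evalRho ρ (C g) = aeval (ρ 1) g := by
  simp [evalRho]

/-- In the quotient by I the seven relations hold for the classes of the variables. Equality of the
angular momenta forces q = 0 and the prescribed ρ̇ⱼ; the other relations force 𝛏 = 0, hence pⱼ = 0.
Each resultant is a combination of pⱼ and q, and 𝔲 a combination of the resultants. -/
theorem inRho2_uPoly_mem (d : LinkData) (hK : crossD d ⬝ᵥ crossD d ≠ 0) (ha : qA d ≠ 0) :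
    inRho2 (uPoly d) ∈ kepIdeal d := by
  let f : MvPolynomial KepVar ℝ →ₐ[ℝ] MvPolynomial KepVar ℝ ⧸ kepIdeal d :=
    Ideal.Quotient.mkₐ ℝ (kepIdeal d)
  have hf {x y : MvPolynomial KepVar ℝ} (h : x - y ∈ kepIdeal d) : f x = f y :=
    Ideal.Quotient.eq.mpr h
  let ρ : Fin 2 → MvPolynomial KepVar ℝ ⧸ kepIdeal d := fun j => f (MvPolynomial.X (.rho j))
  let ρ' : Fin 2 → MvPolynomial KepVar ℝ ⧸ kepIdeal d := fun j => f (MvPolynomial.X (.rhoDot j))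
  let u : Fin 2 → MvPolynomial KepVar ℝ ⧸ kepIdeal d := fun j => f (MvPolynomial.X (.u j))
  have hc : angMom (d 0) (ρ 0) (ρ' 0) = angMom (d 1) (ρ 1) (ρ' 1) := by
    ext i
    rw [← map_angMom, ← map_angMom]
    exact hf (Ideal.subset_span (Or.inl (Or.inl ⟨i, rfl⟩)))
  have hL : muLenz (d 0) (ρ 0) (ρ' 0) (u 0) = muLenz (d 1) (ρ 1) (ρ' 1) (u 1) := by
    ext i
    rw [← map_muLenz, ← map_muLenz]
    exact hf (Ideal.subset_span (Or.inl (Or.inr ⟨i, rfl⟩)))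
  have hE : energy (d 0) (ρ 0) (ρ' 0) (u 0) = energy (d 1) (ρ 1) (ρ' 1) (u 1) := by
    rw [← map_energy, ← map_energy]
    exact hf (Ideal.subset_span (Or.inr rfl))
  obtain ⟨hq, hρ'⟩ := eq_of_angMom_eq d ρ ρ' hK hc
  have hp (j : Fin 2) : pVal d ρ j = 0 := by
    rw [pVal, hρ', xi_eq_xi d ρ ρ' 0 u, xi_eq_zero d ρ ρ' u hL hE, zero_dotProduct]
  have hres (j : Fin 2) : aeval (ρ 1) (uRes d j) = 0 := by
    obtain ⟨s, t, -, -, h⟩ := exists_mul_add_mul_eq_C_resultant (pPoly d j) (qPoly d) le_rfl le_rfl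
      (Or.inr (by rw [natDegree_qPoly d ha]; norm_num))
    rw [← evalRho_C, uRes, ← h, map_add, map_mul, map_mul, pPoly_eq, qPoly_eq, map_pVal, map_qVal,
      evalRho_comp_rhoVar, hp, hq]
    ring
  have hu : aeval (ρ 1) (uPoly d) = 0 := by
    classical
    have := EuclideanDomain.gcd_eq_gcd_ab (uRes d 0) (uRes d 1)
    have h2 : uPoly d = EuclideanDomain.gcd (uRes d 0) (uRes d 1) := by
      unfold uPoly
      congr!
    rw [h2, this, map_add, map_mul, map_mul, hres, hres]
    ring
  rw [← Ideal.Quotient.eq_zero_iff_mem]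
  change f (aeval _ _) = 0
  rw [← aeval_algHom_apply]
  exact hu

end Membership

/-! ### Minimality of the degree via a zero of I over ℝ[X]/(h). -/

section LowerBound

/-- If `q`, `p₁`, `p₂` have a common zero in `ℝ[X]/(h)` whose second coordinate is the class of
`X`, then `h` divides all the polynomials in `ρ₂` alone that belong to the ideal. -/
theorem dvd_of_inRho2_mem (d : LinkData) (hK : crossD d ⬝ᵥ crossD d ≠ 0)
    (hτ : ((d 0).los ⨯₃ (d 1).los) ⬝ᵥ ((d 0).obsPos - (d 1).obsPos) ≠ 0) (h : ℝ[X])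
    (ρ : Fin 2 → ℝ[X] ⧸ Ideal.span {h}) (hρ : ρ 1 = Ideal.Quotient.mk _ X)
    (hq : qVal d ρ = 0) (hp : ∀ j, pVal d ρ j = 0) {g : ℝ[X]} (hg : inRho2 g ∈ kepIdeal d) :
    h ∣ g := by
  obtain ⟨ρ', u, hc, hL, hE⟩ := exists_conservation d ρ hK hτ hq hp
  let val : KepVar → ℝ[X] ⧸ Ideal.span {h} := fun v => match v with
    | .rho j => ρ j
    | .rhoDot j => ρ' j
    | .u j => u j
  let f : MvPolynomial KepVar ℝ →ₐ[ℝ] ℝ[X] ⧸ Ideal.span {h} := MvPolynomial.aeval val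
  have h1 (j : Fin 2) : f (MvPolynomial.X (.rho j)) = ρ j := MvPolynomial.aeval_X _ _
  have h2 (j : Fin 2) : f (MvPolynomial.X (.rhoDot j)) = ρ' j := MvPolynomial.aeval_X _ _
  have h3 (j : Fin 2) : f (MvPolynomial.X (.u j)) = u j := MvPolynomial.aeval_X _ _
  -- The point (ρ, ρ', u) satisfies the conservation laws, so evaluation at it kills the generators
  -- of I. As it sends ρ₂ to the class of X, the image of g is the class of g itself.
  have hker : kepIdeal d ≤ RingHom.ker f := by
    refine Ideal.span_le.mpr ?_
    rintro x ((⟨i, rfl⟩ | ⟨i, rfl⟩) | hx)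
    · change f _ = 0
      rw [map_sub, angMomPoly, angMomPoly, map_angMom, map_angMom, h1, h1, h2, h2, hc, sub_self]
    · change f _ = 0
      rw [map_sub, muLenzPoly, muLenzPoly, map_muLenz, map_muLenz, h1, h1, h2, h2, h3, h3, hL,
        sub_self]
    · rw [Set.mem_singleton_iff.mp hx]
      change f _ = 0
      rw [map_sub, energyPoly, energyPoly, map_energy, map_energy, h1, h1, h2, h2, h3, h3, hE,
        sub_self]
  have hfg : f (inRho2 g) = 0 := hker hg
  rw [inRho2, ← aeval_algHom_apply, h1, hρ] at hfg
  have : aeval (Ideal.Quotient.mkₐ ℝ (Ideal.span {h}) X) g = 0 := hfg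
  rw [aeval_algHom_apply, aeval_X_left_apply] at this
  exact Ideal.mem_span_singleton.mp (Ideal.Quotient.eq_zero_iff_mem.mp this)

/-- Send ω to -re/im. The norm divided by im² is exactly the equation ω² = a + bω at this value, so
the assignment extends to a homomorphism. -/
theorem exists_algHom_apply_eq_zero {R T : Type*} [CommRing R] [CommRing T] [Algebra R T] {a b : R}
    {z : QuadraticAlgebra R a b} (hN : algebraMap R T z.norm = 0)
    (hA : IsUnit (algebraMap R T z.im)) :
    ∃ ψ : QuadraticAlgebra R a b →ₐ[R] T, ψ z = 0 := by
  rw [QuadraticAlgebra.norm_def] at hN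
  simp only [map_sub, map_add, map_mul] at hN
  obtain ⟨v, hv⟩ := hA.exists_left_inv
  have hx : (-(algebraMap R T z.re * v)) * (-(algebraMap R T z.re * v))
      = a • 1 + b • (-(algebraMap R T z.re * v)) := by
    rw [Algebra.smul_def, Algebra.smul_def]
    linear_combination v ^ 2 * hN + (algebraMap R T a * (v * algebraMap R T z.im + 1)
      - algebraMap R T b * algebraMap R T z.re * v) * hv
  refine ⟨QuadraticAlgebra.lift ⟨_, hx⟩, ?_⟩
  rw [QuadraticAlgebra.lift_apply_apply, Algebra.smul_def, Algebra.smul_def]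
  linear_combination -algebraMap R T z.re * hv

/-- A common zero of `q`, `p₁` and `p₂` with values in an algebra over `ℝ[ρ₂]` in which the norm of
`p₁` vanishes. -/
theorem exists_common_zero (d : LinkData) {T : Type} [CommRing T] [Algebra ℝ[X] T] [Algebra ℝ T]
    [IsScalarTower ℝ ℝ[X] T] (hK : crossD d ⬝ᵥ crossD d ≠ 0) (ha : qA d ≠ 0)
    (hN : algebraMap ℝ[X] T (conicP d 0).norm = 0)
    (hA : IsUnit (algebraMap ℝ[X] T (conicP d 0).im))
    (hL : IsUnit (algebraMap ℝ[X] T (conicL d).norm)) :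
    ∃ ρ : Fin 2 → T, ρ 1 = algebraMap ℝ[X] T X ∧ qVal d ρ = 0 ∧ ∀ j, pVal d ρ j = 0 := by
  obtain ⟨ψ, hψ0⟩ := exists_algHom_apply_eq_zero hN hA
  let ψ' : Conic d →ₐ[ℝ] T := ψ.restrictScalars ℝ
  have hLu : IsUnit (ψ (conicL d)) := by
    refine isUnit_of_mul_isUnit_left (y := ψ (star (conicL d))) ?_
    rw [← map_mul, ← QuadraticAlgebra.algebraMap_norm_eq_mul_star, AlgHom.commutes]
    exact hL
  -- The image of 𝐜₁ · 𝐞^ρ₁ is a unit because its norm is, so p₁ = 0 forces p₂ = 0 through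
  -- `pVal_mul_eq`.
  have hψ1 : ψ (conicP d 1) = 0 := by
    have := congrArg ψ (pVal_mul_eq d (conicPt d) hK (qVal_conicPt d ha))
    rw [map_mul, map_mul ψ (pVal d (conicPt d) 1)] at this
    change ψ (conicP d 0) * _ = ψ (conicP d 1) * ψ (conicL d) at this
    rw [hψ0, zero_mul] at this
    exact (hLu.mul_left_eq_zero).mp this.symm
  refine ⟨ψ' ∘ conicPt d, ψ.commutes X, ?_, ?_⟩
  · rw [← map_qVal, qVal_conicPt d ha, map_zero]
  · intro j
    rw [← map_pVal]
    fin_cases j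
    · exact hψ0
    · exact hψ1

/-- The conclusion of the theorem for data that satisfy explicit non-degeneracy conditions. -/
theorem uPoly_of_nondegenerate (d : LinkData) (hK : crossD d ⬝ᵥ crossD d ≠ 0)
    (hτ : ((d 0).los ⨯₃ (d 1).los) ⬝ᵥ ((d 0).obsPos - (d 1).obsPos) ≠ 0) (ha : qA d ≠ 0)
    (hc : qC2 d ≠ 0) (h0 : losF (d 0) ≠ 0) (h1 : losF (d 1) ≠ 0) (hs : rootOne d - rootTwo d ≠ 0)
    (hdeg : (conicP d 0).norm.coeff 10 ≠ 0) (hcop : IsCoprime (conicP d 0).im (conicP d 0).re)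
    (hone : (derivative (conicP d 0).norm).eval (rootOne d) ≠ 0)
    (htwo : (conicP d 0).norm.eval (rootTwo d) ≠ 0) :
    (uPoly d).natDegree = 9 ∧ inRho2 (uPoly d) ∈ kepIdeal d ∧
      ∀ g : ℝ[X], g ≠ 0 → inRho2 g ∈ kepIdeal d → (uPoly d).natDegree ≤ g.natDegree := by
  obtain ⟨h, hN, hass⟩ := exists_common_factor d hK ha hc h0 h1 (sub_ne_zero.mp hs)
  have hdegN : (conicP d 0).norm.natDegree = 10 :=
    natDegree_eq_of_le_of_coeff_ne_zero
      (natDegree_le_of_degree_le (degLE_conicP_zero (d := d)).degree_norm_le) hdeg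
  have hN0 : (conicP d 0).norm ≠ 0 := by
    intro h
    rw [h] at hdeg
    simp at hdeg
  have hh0 : h ≠ 0 := by
    rintro rfl
    exact hN0 (by rw [hN, mul_zero])
  have hh9 : h.natDegree = 9 := by
    rw [hN, natDegree_mul (X_sub_C_ne_zero _) hh0, natDegree_X_sub_C] at hdegN
    omega
  have hu9 : (uPoly d).natDegree = h.natDegree :=
    natDegree_eq_of_degree_eq (degree_eq_degree_of_associated hass)
  refine ⟨hu9.trans hh9, inRho2_uPoly_mem d hK ha, fun g hg hgI => ?_⟩
  rw [hu9]
  refine natDegree_le_of_dvd ?_ hg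
  -- Since N(p₁) = (X - r₁)h, the derivative of N(p₁) at r₁ equals h(r₁).
  have hh1 : h.eval (rootOne d) ≠ 0 := by
    rw [hN, derivative_mul] at hone
    simpa using hone
  have hh2 : h.eval (rootTwo d) ≠ 0 := by
    rw [hN, eval_mul] at htwo
    exact right_ne_zero_of_mul htwo
  have hroot (r : ℝ) (hr : h.eval r ≠ 0) : IsCoprime (X - C r) h := by
    refine (EuclideanDomain.dvd_or_coprime _ _ (irreducible_X_sub_C r)).resolve_left ?_
    rwa [dvd_iff_isRoot]
  have hunit (x : ℝ[X]) (hx : IsCoprime x h) :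
      IsUnit (algebraMap ℝ[X] (ℝ[X] ⧸ Ideal.span {h}) x) := by
    obtain ⟨s, t, hst⟩ := hx
    refine IsUnit.of_mul_eq_one (Ideal.Quotient.mk _ s) ?_
    change Ideal.Quotient.mk _ x * Ideal.Quotient.mk _ s = 1
    rw [← map_mul, ← map_one (Ideal.Quotient.mk _), Ideal.Quotient.eq, Ideal.mem_span_singleton]
    exact ⟨-t, by linear_combination hst⟩
  have hconst (k : ℝ) (hk : k ≠ 0) : IsCoprime (C k) h :=
    ⟨C k⁻¹, 0, by rw [← C_mul, inv_mul_cancel₀ hk, C_1, zero_mul, add_zero]⟩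
  -- N(p₁) ≡ re² modulo im, so coprimality of im and re makes im coprime to N(p₁) and to its factor
  -- h.
  have hAh : IsCoprime (conicP d 0).im h := by
    have h2 : IsCoprime (conicP d 0).im (conicP d 0).norm := by
      have h3 : (conicP d 0).norm = (conicP d 0).re * (conicP d 0).re
          + (conicP d 0).im * (conicIm d * (conicP d 0).re - conicRe d * (conicP d 0).im) := by
        rw [QuadraticAlgebra.norm_def]
        ring
      rw [h3]
      exact (IsCoprime.add_mul_left_right_iff).mpr (hcop.mul_right hcop)
    rw [hN] at h2
    exact h2.of_mul_right_right
  have hLh : IsCoprime (conicL d).norm h := by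
    rw [norm_conicL d ha hc h0 h1]
    exact (hconst _ (div_ne_zero (mul_ne_zero (pow_ne_zero 2 h0) hc) ha)).mul_left
      ((hroot _ hh2).mul_left (hroot _ hh1))
  obtain ⟨ρ, hρ, hq, hp⟩ := exists_common_zero d (T := ℝ[X] ⧸ Ideal.span {h}) hK ha
    (by
      rw [hN]
      exact Ideal.Quotient.eq_zero_iff_mem.mpr (Ideal.mem_span_singleton.mpr (dvd_mul_left _ _)))
    (hunit _ hAh)
    (hunit _ hLh)
  exact dvd_of_inRho2_mem d hK hτ h ρ hρ hq hp hgI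

end LowerBound

/-! ### Quotients of analytic functions of the data, and genericity. -/

section Regular

variable {E : Type} [NormedAddCommGroup E] [NormedSpace ℝ E]

/-- The functions that are quotients of two analytic functions, the denominator of which does not
vanish at `x₀`. -/
def regularAt (x₀ : E) : Subring (E → ℝ) where
  carrier := {f | ∃ K F : E → ℝ, AnalyticOnNhd ℝ K Set.univ ∧ AnalyticOnNhd ℝ F Set.univ ∧
    K x₀ ≠ 0 ∧ ∀ x, K x ≠ 0 → f x * K x = F x}
  mul_mem' := by
    rintro f g ⟨K, F, hK, hF, h0, h⟩ ⟨K', F', hK', hF', h0', h'⟩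
    refine ⟨K * K', F * F', hK.mul hK', hF.mul hF', mul_ne_zero h0 h0', fun x hx => ?_⟩
    have e := h x (left_ne_zero_of_mul hx)
    have e' := h' x (right_ne_zero_of_mul hx)
    simp only [Pi.mul_apply]
    rw [← e, ← e']
    ring
  one_mem' := ⟨fun _ => 1, fun _ => 1, analyticOnNhd_const, analyticOnNhd_const,
    one_ne_zero, by simp⟩
  add_mem' := by
    rintro f g ⟨K, F, hK, hF, h0, h⟩ ⟨K', F', hK', hF', h0', h'⟩
    refine ⟨K * K', F * K' + F' * K, hK.mul hK', (hF.mul hK').add (hF'.mul hK),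
      mul_ne_zero h0 h0', fun x hx => ?_⟩
    have e := h x (left_ne_zero_of_mul hx)
    have e' := h' x (right_ne_zero_of_mul hx)
    simp only [Pi.mul_apply, Pi.add_apply]
    rw [← e, ← e']
    ring
  zero_mem' := ⟨fun _ => 1, fun _ => 0, analyticOnNhd_const, analyticOnNhd_const,
    one_ne_zero, by simp⟩
  neg_mem' := by
    rintro f ⟨K, F, hK, hF, h0, h⟩
    refine ⟨K, -F, hK, hF.neg, h0, fun x hx => ?_⟩
    simp only [Pi.neg_apply]
    rw [← h x hx]
    ring

variable {x₀ : E}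

theorem mem_regularAt_of_analytic {f : E → ℝ} (hf : AnalyticOnNhd ℝ f Set.univ) :
    f ∈ regularAt x₀ :=
  ⟨fun _ => 1, f, analyticOnNhd_const, hf, one_ne_zero, by simp⟩

theorem const_mem_regularAt (c : ℝ) : (fun _ => c) ∈ regularAt x₀ :=
  mem_regularAt_of_analytic analyticOnNhd_const

/-- If f = F/K then 1/f = K²/(KF). The extra factor K in the denominator confines the identity to
points where f = F/K is known. -/
theorem inv_mem_regularAt {f : E → ℝ} (hf : f ∈ regularAt x₀) (h0 : f x₀ ≠ 0) :
    (fun x => (f x)⁻¹) ∈ regularAt x₀ := by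
  obtain ⟨K, F, hK, hF, hK0, h⟩ := hf
  refine ⟨K * F, K * K, hK.mul hF, hK.mul hK, ?_, fun x hx => ?_⟩
  · rw [Pi.mul_apply, ← h x₀ hK0]
    exact mul_ne_zero hK0 (mul_ne_zero h0 hK0)
  · have hKx := left_ne_zero_of_mul hx
    have hFx : F x ≠ 0 := right_ne_zero_of_mul hx
    rw [← h x hKx] at hFx
    have hfx : f x ≠ 0 := left_ne_zero_of_mul hFx
    simp only [Pi.mul_apply]
    rw [← h x hKx]
    field_simp

theorem div_mem_regularAt {f g : E → ℝ} (hf : f ∈ regularAt x₀) (hg : g ∈ regularAt x₀)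
    (h0 : g x₀ ≠ 0) : (fun x => f x / g x) ∈ regularAt x₀ := by
  simp only [div_eq_mul_inv]
  exact mul_mem hf (inv_mem_regularAt hg h0)

omit [NormedAddCommGroup E] [NormedSpace ℝ E] in
theorem apply_ne_zero_of_mul_apply_ne_zero {f g : E → ℝ} {x : E} (h : (f * g) x ≠ 0) :
    f x ≠ 0 ∧ g x ≠ 0 :=
  ⟨left_ne_zero_of_mul h, right_ne_zero_of_mul h⟩

/-- If f = F/K, the product KF is analytic on the whole data space, is nonzero at d₀, and where it
is nonzero so is f. -/
theorem generic_of_mem_regularAt {d₀ : LinkData} {f : LinkData → ℝ} (hf : f ∈ regularAt d₀)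
    (h0 : f d₀ ≠ 0) {P : LinkData → Prop} (hP : ∀ d, f d ≠ 0 → P d) : Generic P := by
  obtain ⟨K, F, hK, hF, hK0, h⟩ := hf
  refine ⟨K * F, hK.mul hF, ⟨d₀, ?_⟩, fun d hd => hP d ?_⟩
  · rw [Pi.mul_apply, ← h d₀ hK0]
    exact mul_ne_zero hK0 (mul_ne_zero h0 hK0)
  · have hFd : F d ≠ 0 := right_ne_zero_of_mul hd
    rw [← h d (left_ne_zero_of_mul hd)] at hFd
    exact left_ne_zero_of_mul hFd

/-- The families of polynomials whose coefficients are regular. -/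
def regularPoly (x₀ : E) : Subring (E → ℝ[X]) where
  carrier := {F | ∀ n, (fun x => (F x).coeff n) ∈ regularAt x₀}
  mul_mem' := by
    intro F G hF hG n
    have : (fun x => ((F * G) x).coeff n)
        = ∑ p ∈ Finset.HasAntidiagonal.antidiagonal n,
          (fun x => (F x).coeff p.1) * (fun x => (G x).coeff p.2) := by
      ext x
      simp [coeff_mul]
    rw [this]
    exact sum_mem fun p _ => mul_mem (hF p.1) (hG p.2)
  one_mem' n := const_mem_regularAt _
  add_mem' := by
    intro F G hF hG n
    simp only [Pi.add_apply, coeff_add]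
    exact add_mem (hF n) (hG n)
  zero_mem' n := const_mem_regularAt _
  neg_mem' := by
    intro F hF n
    simp only [Pi.neg_apply, coeff_neg]
    exact neg_mem (hF n)

theorem const_mem_regularPoly (p : ℝ[X]) : (fun _ => p) ∈ regularPoly x₀ :=
  fun _ => const_mem_regularAt _

theorem C_mem_regularPoly {f : E → ℝ} (hf : f ∈ regularAt x₀) :
    (fun x => C (f x)) ∈ regularPoly x₀ := by
  intro n
  by_cases hn : n = 0
  · simpa [hn] using hf
  · simp only [coeff_C, hn, if_false]
    exact const_mem_regularAt 0

/-- A degree bound uniform in x is needed to write the value as one finite sum valid for all x. -/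
theorem eval_mem_regularAt {F : E → ℝ[X]} (hF : F ∈ regularPoly x₀) {s : E → ℝ}
    (hs : s ∈ regularAt x₀) {n : ℕ} (hn : ∀ x, (F x).natDegree < n) :
    (fun x => (F x).eval (s x)) ∈ regularAt x₀ := by
  have : (fun x => (F x).eval (s x))
      = ∑ i ∈ Finset.range n, (fun x => (F x).coeff i) * s ^ i := by
    ext x
    simp [eval_eq_sum_range' (hn x)]
  rw [this]
  exact sum_mem fun i _ => mul_mem (hF i) (pow_mem hs i)

theorem derivative_mem_regularPoly {F : E → ℝ[X]} (hF : F ∈ regularPoly x₀) :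
    (fun x => derivative (F x)) ∈ regularPoly x₀ := by
  intro n
  simp only [coeff_derivative]
  exact mul_mem (hF (n + 1)) (const_mem_regularAt _)

/-- With fixed formal degrees the resultant is one and the same polynomial in the coefficients for
all x, even where the actual degrees drop. -/
theorem resultant_mem_regularAt {F G : E → ℝ[X]} (hF : F ∈ regularPoly x₀)
    (hG : G ∈ regularPoly x₀) (m n : ℕ) :
    (fun x => resultant (F x) (G x) m n) ∈ regularAt x₀ := by
  have hent (i j : Fin (m + n)) : (fun x => sylvester (F x) (G x) m n i j) ∈ regularAt x₀ := by
    simp only [sylvester, Matrix.of_apply]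
    induction j using Fin.addCases with
    | left j =>
      simp only [Fin.addCases_left]
      split_ifs
      · exact hG _
      · exact const_mem_regularAt 0
    | right j =>
      simp only [Fin.addCases_right]
      split_ifs
      · exact hF _
      · exact const_mem_regularAt 0
  have : (fun x => resultant (F x) (G x) m n) = ∑ σ : Equiv.Perm (Fin (m + n)),
      (fun _ => ((Equiv.Perm.sign σ : ℤ) : ℝ)) *
        ∏ i, (fun x => sylvester (F x) (G x) m n (σ i) i) := by
    ext x
    simp [resultant, Matrix.det_apply']
  rw [this]
  exact sum_mem fun σ _ => mul_mem (const_mem_regularAt _) (prod_mem fun i _ => hent _ _)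

/-- Too large a formal degree of f only contributes a sign and a power of the leading coefficient of
g, so g must be taken with its exact degree. -/
theorem resultant_ne_zero_of_isCoprime {K : Type*} [Field K] {f g : K[X]} {m : ℕ}
    (hf : f.natDegree ≤ m) (hg : g ≠ 0) (h : IsCoprime f g) :
    resultant f g m g.natDegree ≠ 0 := by
  obtain ⟨k, rfl⟩ := Nat.exists_eq_add_of_le hf
  rw [resultant_add_left_deg _ _ _ _ _ le_rfl]
  refine mul_ne_zero (mul_ne_zero (pow_ne_zero _ (by simp)) (pow_ne_zero _ ?_))
    (resultant_ne_zero _ _ h)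
  rwa [coeff_natDegree, leadingCoeff_ne_zero]

theorem isCoprime_of_resultant_ne_zero {K : Type*} [Field K] {f g : K[X]} {m n : ℕ}
    (hf : f.natDegree ≤ m) (hg : g.natDegree ≤ n) (hmn : m ≠ 0 ∨ n ≠ 0)
    (h : resultant f g m n ≠ 0) : IsCoprime f g := by
  obtain ⟨p, q, -, -, e⟩ := exists_mul_add_mul_eq_C_resultant f g hf hg hmn
  refine ⟨C (resultant f g m n)⁻¹ * p, C (resultant f g m n)⁻¹ * q, ?_⟩
  have : C (resultant f g m n)⁻¹ * C (resultant f g m n) = 1 := by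
    rw [← C_mul, inv_mul_cancel₀ h, C_1]
  linear_combination C (resultant f g m n)⁻¹ * e + this

end Regular

/-! ### Families of vectors over rings that vary with the data, as `Conic d` does. -/

section VectorFamilies

variable {ι : Type} {S : ι → Type} [∀ i, CommRing (S i)] (A : Subring (∀ i, S i))

/-- The families of vectors all of whose components lie in a given ring of families. -/
def vecFamilies : AddSubgroup (∀ i, Fin 3 → S i) where
  carrier := {v | ∀ k, (fun i => v i k) ∈ A}
  add_mem' hv hw k := add_mem (hv k) (hw k)
  zero_mem' _ := zero_mem A
  neg_mem' hv k := neg_mem (hv k)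

variable {A}

theorem smul_mem_vecFamilies {z : ∀ i, S i} {v : ∀ i, Fin 3 → S i} (hz : z ∈ A)
    (hv : v ∈ vecFamilies A) : (fun i => z i • v i) ∈ vecFamilies A :=
  fun k => mul_mem hz (hv k)

theorem dot_mem_of_mem_vecFamilies {v w : ∀ i, Fin 3 → S i} (hv : v ∈ vecFamilies A)
    (hw : w ∈ vecFamilies A) : (fun i => v i ⬝ᵥ w i) ∈ A := by
  simp only [dotProduct, Fin.sum_univ_three]
  exact add_mem (add_mem (mul_mem (hv 0) (hw 0)) (mul_mem (hv 1) (hw 1))) (mul_mem (hv 2) (hw 2))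

theorem cross_mem_vecFamilies {v w : ∀ i, Fin 3 → S i} (hv : v ∈ vecFamilies A)
    (hw : w ∈ vecFamilies A) : (fun i => v i ⨯₃ w i) ∈ vecFamilies A := by
  intro k
  simp only [cross_apply]
  fin_cases k
  · exact sub_mem (mul_mem (hv 1) (hw 2)) (mul_mem (hv 2) (hw 1))
  · exact sub_mem (mul_mem (hv 2) (hw 0)) (mul_mem (hv 0) (hw 2))
  · exact sub_mem (mul_mem (hv 0) (hw 1)) (mul_mem (hv 1) (hw 0))

theorem lenzRest_mem_vecFamilies {h : ∀ i, S i} {r v : ∀ i, Fin 3 → S i} (hh : h ∈ A)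
    (hr : r ∈ vecFamilies A) (hv : v ∈ vecFamilies A) :
    (fun i => lenzRest (h i) (r i) (v i)) ∈ vecFamilies A :=
  sub_mem (smul_mem_vecFamilies (mul_mem hh (dot_mem_of_mem_vecFamilies hv hv)) hr)
    (smul_mem_vecFamilies (dot_mem_of_mem_vecFamilies hr hv) hv)

end VectorFamilies

/-! ### Regular dependence of the coefficients on the data. -/

section DataFamilies

variable {d₀ : LinkData}

theorem attributable_mem_regularAt (j : Fin 2) (k : Fin 4) :
    (fun d : LinkData => (d j).1 k) ∈ regularAt d₀ :=
  mem_regularAt_of_analytic <| fun _ _ =>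
    ((ContinuousLinearMap.proj (R := ℝ) (φ := fun _ : Fin 4 => ℝ) k).comp
      ((ContinuousLinearMap.fst ℝ _ _).comp
        (ContinuousLinearMap.proj (R := ℝ) (φ := fun _ : Fin 2 => EpochData) j))).analyticAt _

theorem cos_mem_regularAt (j : Fin 2) (k : Fin 4) :
    (fun d : LinkData => Real.cos ((d j).1 k)) ∈ regularAt d₀ :=
  mem_regularAt_of_analytic <| fun _ _ => Real.analyticAt_cos.comp <|
    ((ContinuousLinearMap.proj (R := ℝ) (φ := fun _ : Fin 4 => ℝ) k).comp
      ((ContinuousLinearMap.fst ℝ _ _).comp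
        (ContinuousLinearMap.proj (R := ℝ) (φ := fun _ : Fin 2 => EpochData) j))).analyticAt _

theorem sin_mem_regularAt (j : Fin 2) (k : Fin 4) :
    (fun d : LinkData => Real.sin ((d j).1 k)) ∈ regularAt d₀ :=
  mem_regularAt_of_analytic <| fun _ _ => Real.analyticAt_sin.comp <|
    ((ContinuousLinearMap.proj (R := ℝ) (φ := fun _ : Fin 4 => ℝ) k).comp
      ((ContinuousLinearMap.fst ℝ _ _).comp
        (ContinuousLinearMap.proj (R := ℝ) (φ := fun _ : Fin 2 => EpochData) j))).analyticAt _

theorem obsPos_mem (j : Fin 2) :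
    (fun d : LinkData => (d j).obsPos) ∈ vecFamilies (regularAt d₀) := fun k =>
  mem_regularAt_of_analytic <| fun _ _ =>
    ((ContinuousLinearMap.proj (R := ℝ) (φ := fun _ : Fin 3 => ℝ) k).comp
      ((ContinuousLinearMap.fst ℝ _ _).comp ((ContinuousLinearMap.snd ℝ _ _).comp
        (ContinuousLinearMap.proj (R := ℝ) (φ := fun _ : Fin 2 => EpochData) j)))).analyticAt _

theorem obsVel_mem (j : Fin 2) :
    (fun d : LinkData => (d j).obsVel) ∈ vecFamilies (regularAt d₀) := fun k =>
  mem_regularAt_of_analytic <| fun _ _ =>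
    ((ContinuousLinearMap.proj (R := ℝ) (φ := fun _ : Fin 3 => ℝ) k).comp
      ((ContinuousLinearMap.snd ℝ _ _).comp ((ContinuousLinearMap.snd ℝ _ _).comp
        (ContinuousLinearMap.proj (R := ℝ) (φ := fun _ : Fin 2 => EpochData) j)))).analyticAt _

theorem los_mem (j : Fin 2) :
    (fun d : LinkData => (d j).los) ∈ vecFamilies (regularAt d₀) := by
  intro k
  fin_cases k
  · exact mul_mem (cos_mem_regularAt j 1) (cos_mem_regularAt j 0)
  · exact mul_mem (cos_mem_regularAt j 1) (sin_mem_regularAt j 0)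
  · exact sin_mem_regularAt j 1

theorem eta_mem (j : Fin 2) :
    (fun d : LinkData => (d j).eta) ∈ vecFamilies (regularAt d₀) := by
  refine add_mem (smul_mem_vecFamilies (mul_mem (attributable_mem_regularAt j 2)
    (cos_mem_regularAt j 1)) (v := fun d : LinkData => eAlpha (d j).ra) ?_)
    (smul_mem_vecFamilies (attributable_mem_regularAt j 3)
      (v := fun d : LinkData => eDelta (d j).ra (d j).dec) ?_)
  · intro k
    fin_cases k
    · exact neg_mem (sin_mem_regularAt j 0)
    · exact cos_mem_regularAt j 0
    · exact const_mem_regularAt 0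
  · intro k
    fin_cases k
    · exact mul_mem (neg_mem (sin_mem_regularAt j 1)) (cos_mem_regularAt j 0)
    · exact mul_mem (neg_mem (sin_mem_regularAt j 1)) (sin_mem_regularAt j 0)
    · exact cos_mem_regularAt j 1

theorem vecD_mem (j : Fin 2) : (fun d : LinkData => (d j).vecD) ∈ vecFamilies (regularAt d₀) :=
  cross_mem_vecFamilies (obsPos_mem j) (los_mem j)

theorem vecE_mem (j : Fin 2) : (fun d : LinkData => (d j).vecE) ∈ vecFamilies (regularAt d₀) :=
  cross_mem_vecFamilies (los_mem j) (eta_mem j)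

theorem vecF_mem (j : Fin 2) : (fun d : LinkData => (d j).vecF) ∈ vecFamilies (regularAt d₀) :=
  add_mem (cross_mem_vecFamilies (obsPos_mem j) (eta_mem j))
    (cross_mem_vecFamilies (los_mem j) (obsVel_mem j))

theorem vecG_mem (j : Fin 2) : (fun d : LinkData => (d j).vecG) ∈ vecFamilies (regularAt d₀) :=
  cross_mem_vecFamilies (obsPos_mem j) (obsVel_mem j)

theorem crossD_mem : crossD ∈ vecFamilies (regularAt d₀) :=
  cross_mem_vecFamilies (vecD_mem 0) (vecD_mem 1)

theorem qA_mem : qA ∈ regularAt d₀ :=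
  neg_mem (dot_mem_of_mem_vecFamilies crossD_mem (vecE_mem 0))

theorem qB_mem : qB ∈ regularAt d₀ :=
  neg_mem (dot_mem_of_mem_vecFamilies crossD_mem (vecF_mem 0))

theorem qC2_mem : qC2 ∈ regularAt d₀ := dot_mem_of_mem_vecFamilies crossD_mem (vecE_mem 1)

theorem qC1_mem : qC1 ∈ regularAt d₀ := dot_mem_of_mem_vecFamilies crossD_mem (vecF_mem 1)

theorem qC0_mem : qC0 ∈ regularAt d₀ :=
  sub_mem (dot_mem_of_mem_vecFamilies crossD_mem (vecG_mem 1))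
    (dot_mem_of_mem_vecFamilies crossD_mem (vecG_mem 0))

theorem losF_mem (j : Fin 2) : (fun d : LinkData => losF (d j)) ∈ regularAt d₀ :=
  dot_mem_of_mem_vecFamilies (vecF_mem j) (los_mem j)

theorem losG_mem (j : Fin 2) : (fun d : LinkData => losG (d j)) ∈ regularAt d₀ :=
  dot_mem_of_mem_vecFamilies (vecG_mem j) (los_mem j)

theorem rootTwo_mem (h1 : losF (d₀ 1) ≠ 0) : rootTwo ∈ regularAt d₀ :=
  neg_mem (div_mem_regularAt (losG_mem 1) (losF_mem 1) h1)

theorem rootOne_mem (hc : qC2 d₀ ≠ 0) (h1 : losF (d₀ 1) ≠ 0) : rootOne ∈ regularAt d₀ :=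
  sub_mem (neg_mem (div_mem_regularAt qC1_mem qC2_mem hc)) (rootTwo_mem h1)

theorem conicRe_mem (ha : qA d₀ ≠ 0) : conicRe ∈ regularPoly d₀ :=
  add_mem (add_mem
    (mul_mem (C_mem_regularPoly (neg_mem (div_mem_regularAt qC2_mem qA_mem ha)))
      (const_mem_regularPoly (X ^ 2)))
    (mul_mem (C_mem_regularPoly (neg_mem (div_mem_regularAt qC1_mem qA_mem ha)))
      (const_mem_regularPoly X)))
    (C_mem_regularPoly (neg_mem (div_mem_regularAt qC0_mem qA_mem ha)))

theorem conicIm_mem (ha : qA d₀ ≠ 0) : conicIm ∈ regularPoly d₀ :=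
  C_mem_regularPoly (neg_mem (div_mem_regularAt qB_mem qA_mem ha))

/-- The families of residue classes modulo `q` with regular coefficients. -/
def regularConic (d₀ : LinkData) (ha : qA d₀ ≠ 0) : Subring (∀ d, Conic d) where
  carrier := {z | (fun d => (z d).re) ∈ regularPoly d₀ ∧ (fun d => (z d).im) ∈ regularPoly d₀}
  mul_mem' hz hw := ⟨add_mem (mul_mem hz.1 hw.1) (mul_mem (mul_mem (conicRe_mem ha) hz.2) hw.2),
    add_mem (add_mem (mul_mem hz.1 hw.2) (mul_mem hz.2 hw.1))
      (mul_mem (mul_mem (conicIm_mem ha) hz.2) hw.2)⟩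
  one_mem' := ⟨const_mem_regularPoly 1, const_mem_regularPoly 0⟩
  add_mem' hz hw := ⟨add_mem hz.1 hw.1, add_mem hz.2 hw.2⟩
  zero_mem' := ⟨const_mem_regularPoly 0, const_mem_regularPoly 0⟩
  neg_mem' hz := ⟨neg_mem hz.1, neg_mem hz.2⟩

end DataFamilies

/-! ### Regular dependence of pⱼ on the data. -/

section ValueFamilies

variable {S : LinkData → Type} [∀ d, CommRing (S d)] [∀ d, Algebra ℝ (S d)]
  {A : Subring (∀ d, S d)} {d₀ : LinkData}
  (hA : ∀ f ∈ regularAt d₀, (fun d => algebraMap ℝ (S d) (f d)) ∈ A)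
  {ρ : ∀ d, Fin 2 → S d} (hρ : ∀ j, (fun d => ρ d j) ∈ A)
include hA

theorem emb_mem_vecFamilies {v : LinkData → Fin 3 → ℝ} (hv : v ∈ vecFamilies (regularAt d₀)) :
    (fun d => emb (S d) (v d)) ∈ vecFamilies A :=
  fun k => hA _ (hv k)

include hρ

theorem vecJ_mem_vecFamilies : (fun d => vecJ d (ρ d)) ∈ vecFamilies A :=
  sub_mem (add_mem (sub_mem (add_mem (sub_mem
    (smul_mem_vecFamilies (pow_mem (hρ 1) 2) (emb_mem_vecFamilies hA (vecE_mem 1)))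
    (smul_mem_vecFamilies (pow_mem (hρ 0) 2) (emb_mem_vecFamilies hA (vecE_mem 0))))
    (smul_mem_vecFamilies (hρ 1) (emb_mem_vecFamilies hA (vecF_mem 1))))
    (smul_mem_vecFamilies (hρ 0) (emb_mem_vecFamilies hA (vecF_mem 0))))
    (emb_mem_vecFamilies hA (vecG_mem 1))) (emb_mem_vecFamilies hA (vecG_mem 0))

theorem rhoDotVal_mem_families (hK : crossD d₀ ⬝ᵥ crossD d₀ ≠ 0) (j : Fin 2) :
    (fun d => rhoDotVal d (ρ d) j) ∈ A := by
  have key {v : LinkData → Fin 3 → ℝ} (hv : v ∈ vecFamilies (regularAt d₀)) :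
      (fun d => (crossD d ⬝ᵥ crossD d)⁻¹ •
        ((vecJ d (ρ d) ⨯₃ emb (S d) (v d)) ⬝ᵥ emb (S d) (crossD d))) ∈ A := by
    simp only [Algebra.smul_def]
    exact mul_mem (hA _ (inv_mem_regularAt (dot_mem_of_mem_vecFamilies crossD_mem crossD_mem) hK))
      (dot_mem_of_mem_vecFamilies (cross_mem_vecFamilies (vecJ_mem_vecFamilies hA hρ)
        (emb_mem_vecFamilies hA hv)) (emb_mem_vecFamilies hA crossD_mem))
  fin_cases j
  · exact key (vecD_mem 1)
  · exact key (vecD_mem 0)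

theorem pVal_mem_families (hK : crossD d₀ ⬝ᵥ crossD d₀ ≠ 0) (j : Fin 2) :
    (fun d => pVal d (ρ d) j) ∈ A := by
  have hpos (j : Fin 2) : (fun d => pos (d j) (ρ d j)) ∈ vecFamilies A :=
    add_mem (smul_mem_vecFamilies (hρ j) (emb_mem_vecFamilies hA (los_mem j)))
      (emb_mem_vecFamilies hA (obsPos_mem j))
  have hvel (j : Fin 2) : (fun d => vel (d j) (ρ d j) (rhoDotVal d (ρ d) j)) ∈ vecFamilies A :=
    add_mem (add_mem (smul_mem_vecFamilies (rhoDotVal_mem_families hA hρ hK j)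
      (emb_mem_vecFamilies hA (los_mem j)))
      (smul_mem_vecFamilies (hρ j) (emb_mem_vecFamilies hA (eta_mem j))))
      (emb_mem_vecFamilies hA (obsVel_mem j))
  have hlenz (j : Fin 2) := lenzRest_mem_vecFamilies (hA _ (const_mem_regularAt (1 / 2)))
    (hpos j) (hvel j)
  simp only [pVal, xi_eq_lenzRest]
  exact dot_mem_of_mem_vecFamilies (cross_mem_vecFamilies (sub_mem (hlenz 0) (hlenz 1))
    (sub_mem (hpos 0) (hpos 1))) (emb_mem_vecFamilies hA (los_mem j))

end ValueFamilies

/-! ### From one non-degenerate choice of data to generic data. -/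

section ConicFamilies

variable {d₀ : LinkData}

theorem conicP_mem (hK : crossD d₀ ⬝ᵥ crossD d₀ ≠ 0) (ha : qA d₀ ≠ 0) (j : Fin 2) :
    (fun d => conicP d j) ∈ regularConic d₀ ha := by
  refine pVal_mem_families (ρ := conicPt) (fun f hf => ?_) (fun j => ?_) hK j
  · exact ⟨C_mem_regularPoly hf, const_mem_regularPoly 0⟩
  · fin_cases j
    · exact ⟨const_mem_regularPoly 0, const_mem_regularPoly 1⟩
    · exact ⟨const_mem_regularPoly X, const_mem_regularPoly 0⟩

theorem norm_mem_regularPoly {ha : qA d₀ ≠ 0} {z : ∀ d, Conic d} (hz : z ∈ regularConic d₀ ha) :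
    (fun d => (z d).norm) ∈ regularPoly d₀ := by
  obtain ⟨hre, him⟩ := hz
  have h (d : LinkData) : (z d).norm = (z d).re * (z d).re + conicIm d * (z d).re * (z d).im
      - conicRe d * (z d).im * (z d).im := QuadraticAlgebra.norm_def _
  simp only [h]
  exact sub_mem (add_mem (mul_mem hre hre) (mul_mem (mul_mem (conicIm_mem ha) hre) him))
    (mul_mem (mul_mem (conicRe_mem ha) him) him)

theorem natDegree_conicP_re_le (d : LinkData) : (conicP d 0).re.natDegree ≤ 5 :=
  natDegree_le_of_degree_le (degLE_conicP_zero (d := d)).1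

theorem natDegree_conicP_im_le (d : LinkData) : (conicP d 0).im.natDegree ≤ 4 := by
  refine natDegree_le_of_degree_le ?_
  have h := (degLE_conicP_zero (d := d)).2
  rw [show ((5 : ℕ) : WithBot ℕ) = (4 : ℕ) + 1 by norm_num] at h
  exact (WithBot.add_le_add_iff_right (by simp)).mp h

theorem natDegree_norm_conicP_le (d : LinkData) : (conicP d 0).norm.natDegree ≤ 10 :=
  natDegree_le_of_degree_le (degLE_conicP_zero (d := d)).degree_norm_le

/-- The conclusion of the theorem holds generically if some data satisfy the non-degeneracy
conditions. -/
theorem generic_of_nondegenerate (d₀ : LinkData) (hK : crossD d₀ ⬝ᵥ crossD d₀ ≠ 0)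
    (hτ : ((d₀ 0).los ⨯₃ (d₀ 1).los) ⬝ᵥ ((d₀ 0).obsPos - (d₀ 1).obsPos) ≠ 0) (ha : qA d₀ ≠ 0)
    (hc : qC2 d₀ ≠ 0) (h0 : losF (d₀ 0) ≠ 0) (h1 : losF (d₀ 1) ≠ 0)
    (hs : rootOne d₀ - rootTwo d₀ ≠ 0) (hdeg : (conicP d₀ 0).norm.coeff 10 ≠ 0)
    (hre : (conicP d₀ 0).re.natDegree = 5)
    (hcop : IsCoprime (conicP d₀ 0).im (conicP d₀ 0).re)
    (hone : (derivative (conicP d₀ 0).norm).eval (rootOne d₀) ≠ 0)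
    (htwo : (conicP d₀ 0).norm.eval (rootTwo d₀) ≠ 0) :
    Generic fun d : LinkData => (uPoly d).natDegree = 9 ∧ inRho2 (uPoly d) ∈ kepIdeal d ∧
      ∀ g : ℝ[X], g ≠ 0 → inRho2 g ∈ kepIdeal d → (uPoly d).natDegree ≤ g.natDegree := by
  have mK : (fun d => crossD d ⬝ᵥ crossD d) ∈ regularAt d₀ :=
    dot_mem_of_mem_vecFamilies crossD_mem crossD_mem
  have mτ : (fun d : LinkData => ((d 0).los ⨯₃ (d 1).los) ⬝ᵥ ((d 0).obsPos - (d 1).obsPos))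
      ∈ regularAt d₀ :=
    dot_mem_of_mem_vecFamilies (cross_mem_vecFamilies (los_mem 0) (los_mem 1))
      (sub_mem (obsPos_mem 0) (obsPos_mem 1))
  have mN := norm_mem_regularPoly (conicP_mem hK ha 0)
  have ms := sub_mem (rootOne_mem hc h1) (rootTwo_mem h1)
  have mres : (fun d => resultant (conicP d 0).im (conicP d 0).re 4 5) ∈ regularAt d₀ :=
    resultant_mem_regularAt (conicP_mem hK ha 0).2 (conicP_mem hK ha 0).1 4 5
  have mone : (fun d => (derivative (conicP d 0).norm).eval (rootOne d)) ∈ regularAt d₀ :=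
    eval_mem_regularAt (derivative_mem_regularPoly mN) (rootOne_mem hc h1) (n := 11) fun d =>
      ((natDegree_derivative_le _).trans (Nat.sub_le _ _)).trans_lt
        (Nat.lt_succ_of_le (natDegree_norm_conicP_le d))
  have mtwo : (fun d => (conicP d 0).norm.eval (rootTwo d)) ∈ regularAt d₀ :=
    eval_mem_regularAt mN (rootTwo_mem h1) (n := 11) fun d =>
      Nat.lt_succ_of_le (natDegree_norm_conicP_le d)
  -- Coprimality is encoded by the resultant in formal degrees 4 and 5. At d₀ the polynomial re has
  -- exact degree 5, which allows im to have degree below 4.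
  have hres : resultant (conicP d₀ 0).im (conicP d₀ 0).re 4 5 ≠ 0 := by
    have hne : (conicP d₀ 0).re ≠ 0 := by
      intro h
      rw [h] at hre
      simp at hre
    have := resultant_ne_zero_of_isCoprime (natDegree_conicP_im_le d₀) hne hcop
    rwa [hre] at this
  refine generic_of_mem_regularAt (mul_mem (mul_mem (mul_mem (mul_mem (mul_mem (mul_mem (mul_mem
    (mul_mem (mul_mem (mul_mem mK mτ) qA_mem) qC2_mem) (losF_mem 0)) (losF_mem 1)) ms) (mN 10))
    mres) mone) mtwo) ?_ ?_
  · exact mul_ne_zero (mul_ne_zero (mul_ne_zero (mul_ne_zero (mul_ne_zero (mul_ne_zero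
      (mul_ne_zero (mul_ne_zero (mul_ne_zero (mul_ne_zero hK hτ) ha) hc) h0) h1) hs) hdeg) hres)
      hone) htwo
  · intro d hd
    obtain ⟨hd, k11⟩ := apply_ne_zero_of_mul_apply_ne_zero hd
    obtain ⟨hd, k10⟩ := apply_ne_zero_of_mul_apply_ne_zero hd
    obtain ⟨hd, k9⟩ := apply_ne_zero_of_mul_apply_ne_zero hd
    obtain ⟨hd, k8⟩ := apply_ne_zero_of_mul_apply_ne_zero hd
    obtain ⟨hd, k7⟩ := apply_ne_zero_of_mul_apply_ne_zero hd
    obtain ⟨hd, k6⟩ := apply_ne_zero_of_mul_apply_ne_zero hd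
    obtain ⟨hd, k5⟩ := apply_ne_zero_of_mul_apply_ne_zero hd
    obtain ⟨hd, k4⟩ := apply_ne_zero_of_mul_apply_ne_zero hd
    obtain ⟨hd, k3⟩ := apply_ne_zero_of_mul_apply_ne_zero hd
    obtain ⟨hd, k2⟩ := apply_ne_zero_of_mul_apply_ne_zero hd
    exact uPoly_of_nondegenerate d hd k2 k3 k4 k5 k6 k7 k8
      (isCoprime_of_resultant_ne_zero (natDegree_conicP_im_le d) (natDegree_conicP_re_le d)
        (Or.inl (by norm_num)) k9) k10 k11

end ConicFamilies

/-! ### An explicit choice of data: orthogonal lines of sight, conic ρ₁² = 2ρ₂² - 2. -/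

section Sample

/-- A non-degenerate choice of the data. -/
noncomputable def sampleData : LinkData :=
  ![(![0, 0, 1, 1], ![0, 0, 2], ![1, 0, 0]), (![Real.pi / 2, 0, 2, 0], ![0, 1, 1], ![2, 0, 1])]

theorem los_sampleData_zero : (sampleData 0).los = ![1, 0, 0] := by
  ext i
  fin_cases i <;> simp [sampleData, EpochData.los, EpochData.ra, EpochData.dec, sight]

theorem los_sampleData_one : (sampleData 1).los = ![0, 1, 0] := by
  ext i
  fin_cases i <;> simp [sampleData, EpochData.los, EpochData.ra, EpochData.dec, sight]

theorem eta_sampleData_zero : (sampleData 0).eta = ![0, 1, 1] := by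
  ext i
  fin_cases i <;> simp [sampleData, EpochData.eta, EpochData.ra, EpochData.dec, EpochData.raRate,
    EpochData.decRate, eAlpha, eDelta]

theorem eta_sampleData_one : (sampleData 1).eta = ![-2, 0, 0] := by
  ext i
  fin_cases i <;> simp [sampleData, EpochData.eta, EpochData.ra, EpochData.dec, EpochData.raRate,
    EpochData.decRate, eAlpha, eDelta]

theorem obsPos_sampleData_zero : (sampleData 0).obsPos = ![0, 0, 2] := rfl

theorem obsPos_sampleData_one : (sampleData 1).obsPos = ![0, 1, 1] := rfl

theorem obsVel_sampleData_zero : (sampleData 0).obsVel = ![1, 0, 0] := rfl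

theorem obsVel_sampleData_one : (sampleData 1).obsVel = ![2, 0, 1] := rfl

theorem crossD_sampleData : crossD sampleData = ![0, 0, 2] := by
  simp only [crossD, EpochData.vecD, los_sampleData_zero, los_sampleData_one,
    obsPos_sampleData_zero, obsPos_sampleData_one]
  ext i
  fin_cases i <;> simp [cross_apply]

theorem coeff_sampleData : qA sampleData = -2 ∧ qB sampleData = 0 ∧ qC2 sampleData = 4 ∧
    qC1 sampleData = 0 ∧ qC0 sampleData = -4 := by
  simp only [qA, qB, qC2, qC1, qC0, crossD_sampleData, EpochData.vecE, EpochData.vecF,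
    EpochData.vecG, los_sampleData_zero, los_sampleData_one, eta_sampleData_zero,
    eta_sampleData_one, obsPos_sampleData_zero, obsPos_sampleData_one, obsVel_sampleData_zero,
    obsVel_sampleData_one]
  simp [cross_apply, dotProduct, Fin.sum_univ_three]
  norm_num

theorem los_coeff_sampleData : losF (sampleData 0) = -2 ∧ losF (sampleData 1) = -2 ∧
    losG (sampleData 1) = 2 := by
  simp only [losF, losG, EpochData.vecF,
    EpochData.vecG, los_sampleData_zero, los_sampleData_one, eta_sampleData_zero,
    eta_sampleData_one, obsPos_sampleData_zero, obsPos_sampleData_one, obsVel_sampleData_zero,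
    obsVel_sampleData_one]
  simp [cross_apply, dotProduct, Fin.sum_univ_three]

/-- By the uniqueness in `eq_of_angMom_eq` it suffices to check that the stated velocities give
equal angular momenta on the conic. -/
theorem rhoDotVal_sampleData {S : Type} [CommRing S] [Algebra ℝ S] (x y : S)
    (h : x ^ 2 = 2 * y ^ 2 - 2) :
    rhoDotVal sampleData ![x, y] = ![y ^ 2 - y - 1, 2 * x + y + 1] := by
  have h3 : algebraMap ℝ S 2 = 2 := map_ofNat _ 2
  refine (eq_of_angMom_eq sampleData ![x, y] _ ?_ ?_).2
  · rw [crossD_sampleData]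
    simp [dotProduct, Fin.sum_univ_three]
  · simp only [angMom, pos, vel, los_sampleData_zero, los_sampleData_one, eta_sampleData_zero,
      eta_sampleData_one, obsPos_sampleData_zero, obsPos_sampleData_one, obsVel_sampleData_zero,
      obsVel_sampleData_one]
    ext i
    fin_cases i <;> simp [emb, cross_apply] <;> grind

theorem pVal_sampleData {S : Type} [CommRing S] [Algebra ℝ S] (x y : S)
    (h : x ^ 2 = 2 * y ^ 2 - 2) :
    pVal sampleData ![x, y] 0 = (2 * y ^ 2 + 4 * y + 4) * x
      + (-y ^ 5 - 3 * y ^ 4 + 2 * y ^ 3 + 6 * y ^ 2 + 4 * y + 2) := by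
  rw [pVal, xi_eq_lenzRest, rhoDotVal_sampleData x y h]
  have h3 : algebraMap ℝ S 2 = 2 := map_ofNat _ 2
  have h2 : 2 * algebraMap ℝ S (1 / 2) = 1 := by
    rw [← h3, ← map_mul]
    norm_num
  generalize algebraMap ℝ S (1 / 2) = c at *
  simp only [pos, vel, los_sampleData_zero, los_sampleData_one, eta_sampleData_zero,
      eta_sampleData_one, obsPos_sampleData_zero, obsPos_sampleData_one, obsVel_sampleData_zero,
      obsVel_sampleData_one]
  simp [lenzRest, emb, cross_apply, dotProduct, Fin.sum_univ_three]
  grind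

theorem conicRe_sampleData : conicRe sampleData = 2 * X ^ 2 - 2 := by
  obtain ⟨ha, hb, h2, h1, h0⟩ := coeff_sampleData
  rw [conicRe, ha, h2, h1, h0]
  norm_num
  simp [C_ofNat]
  ring

theorem conicIm_sampleData : conicIm sampleData = 0 := by
  obtain ⟨ha, hb, h2, h1, h0⟩ := coeff_sampleData
  rw [conicIm, hb]
  simp

theorem conicP_sampleData : (conicP sampleData 0).im = 2 * X ^ 2 + 4 * X + 4 ∧
    (conicP sampleData 0).re = -X ^ 5 - 3 * X ^ 4 + 2 * X ^ 3 + 6 * X ^ 2 + 4 * X + 2 := by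
  have homega : (QuadraticAlgebra.omega : Conic sampleData) ^ 2
      = 2 * (algebraMap ℝ[X] (Conic sampleData) X) ^ 2 - 2 := by
    have h : (2 * (algebraMap ℝ[X] (Conic sampleData) X) ^ 2 - 2)
        = algebraMap ℝ[X] (Conic sampleData) (2 * X ^ 2 - 2) := by
      simp only [map_sub, map_mul, map_pow, map_ofNat]
    rw [h, sq, QuadraticAlgebra.omega_mul_omega_eq_mk, ← conicRe_sampleData,
      QuadraticAlgebra.algebraMap_eq]
    exact QuadraticAlgebra.ext rfl conicIm_sampleData
  have h : conicP sampleData 0 = algebraMap ℝ[X] (Conic sampleData) (2 * X ^ 2 + 4 * X + 4)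
        * QuadraticAlgebra.omega + algebraMap ℝ[X] (Conic sampleData)
        (-X ^ 5 - 3 * X ^ 4 + 2 * X ^ 3 + 6 * X ^ 2 + 4 * X + 2) := by
    simp only [map_sub, map_mul, map_pow, map_ofNat, map_neg, map_add]
    exact pVal_sampleData _ _ homega
  rw [h]
  constructor
  · simp only [QuadraticAlgebra.im_add, QuadraticAlgebra.im_mul, QuadraticAlgebra.algebraMap_re,
      QuadraticAlgebra.algebraMap_im, QuadraticAlgebra.omega_re, QuadraticAlgebra.omega_im]
    ring
  · simp only [QuadraticAlgebra.re_add, QuadraticAlgebra.re_mul, QuadraticAlgebra.algebraMap_re,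
      QuadraticAlgebra.algebraMap_im, QuadraticAlgebra.omega_re, QuadraticAlgebra.omega_im]
    ring

theorem norm_conicP_sampleData : (conicP sampleData 0).norm
    = X ^ 10 + 6 * X ^ 9 + 5 * X ^ 8 - 24 * X ^ 7 - 48 * X ^ 6 - 36 * X ^ 5 - 16 * X ^ 4
      + 24 * X ^ 3 + 72 * X ^ 2 + 80 * X + 36 := by
  rw [QuadraticAlgebra.norm_def, conicP_sampleData.1, conicP_sampleData.2, conicRe_sampleData,
    conicIm_sampleData]
  ring

theorem isCoprime_conicP_sampleData :
    IsCoprime (conicP sampleData 0).im (conicP sampleData 0).re := by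
  rw [conicP_sampleData.1, conicP_sampleData.2]
  have h : (C (1 / 20) * 20 : ℝ[X]) = 1 := by
    rw [← C_ofNat, ← C_mul]
    norm_num
  -- Division of re by im leaves the constant remainder 10, with quotient -½(X³ + X² - 6X + 4).
  refine ⟨C (1 / 20) * (X ^ 3 + X ^ 2 - 6 * X + 4), 2 * C (1 / 20), ?_⟩
  linear_combination h

theorem root_sampleData : rootOne sampleData = -1 ∧ rootTwo sampleData = 1 := by
  obtain ⟨-, h1, hg⟩ := los_coeff_sampleData
  obtain ⟨-, -, h2, hc, -⟩ := coeff_sampleData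
  have : rootTwo sampleData = 1 := by
    rw [rootTwo, h1, hg]
    norm_num
  refine ⟨?_, this⟩
  rw [rootOne, this, h2, hc]
  norm_num

end Sample

end KeplerLinkage

open KeplerLinkage in
theorem mainTheorem2 :
    Generic fun d : LinkData =>
      (uPoly d).natDegree = 9 ∧
      inRho2 (uPoly d) ∈ kepIdeal d ∧
      ∀ g : Polynomial ℝ, g ≠ 0 → inRho2 g ∈ kepIdeal d →
        (uPoly d).natDegree ≤ g.natDegree := by
  obtain ⟨ha, -, h2, -, -⟩ := coeff_sampleData
  obtain ⟨h0, h1, -⟩ := los_coeff_sampleData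
  obtain ⟨hr1, hr2⟩ := root_sampleData
  apply generic_of_nondegenerate sampleData
  · rw [crossD_sampleData]
    simp [dotProduct, Fin.sum_univ_three]
  · rw [los_sampleData_zero, los_sampleData_one, obsPos_sampleData_zero, obsPos_sampleData_one]
    simp [cross_apply, dotProduct, Fin.sum_univ_three]
    norm_num
  · rw [ha]
    norm_num
  · rw [h2]
    norm_num
  · rw [h0]
    norm_num
  · rw [h1]
    norm_num
  · rw [hr1, hr2]
    norm_num
  · rw [norm_conicP_sampleData]
    simp [Polynomial.coeff_X]
  · rw [conicP_sampleData.2]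
    compute_degree!
  · exact isCoprime_conicP_sampleData
  · rw [norm_conicP_sampleData, hr1]
    simp
    norm_num
  · rw [norm_conicP_sampleData, hr2]
    simp
    norm_num
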